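/- Let $n\ge 2$ and let $\mathcal M$ be a smooth $n$-manifold with a projective structure, i.e. an equivalence class of torsion-free affine connections $\nabla$ having the same unparametrized geodesics; any two of them are related by a one-form $\Upsilon$ via $\hat\nabla_a\omega_b=\nabla_a\omega_b-\Upsilon_a\omega_b-\Upsilon_b\omega_a$. Let $\mathcal E(w)=(\Lambda^n)^{-w/(n+1)}$ be the (smooth) densities of weight $w\in\mathbb R$ (for non-oriented $\mathcal M$, powers of $|\Lambda^n|$), write $(w)$ for the tensor product with $\mathcal E(w)$, and let $P_{ab}$ be the Schouten tensor of $\nabla$, given by $R_{ab}{}^c{}_d=C_{ab}{}^c{}_d+\delta_a{}^cP_{bd}-\delta_b{}^cP_{ad}+(P_{ba}-P_{ab})\delta_d{}^c$ with $C$ trace-free, where $(\nabla_a\nabla_b-\nabla_b\nabla_a)V^c=R_{ab}{}^c{}_dV^d$. The standard tractor bundle $\mathcal E^A$ has sections which, for each $\nabla$ in the class, are pairs $(V^a,\sigma)$ with $V^a\in\mathcal E^a(-1)$, $\sigma\in\mathcal E(-1)$, and which change by $(V^a,\sigma)\mapsto(V^a,\sigma-\Upsilon_aV^a)$ when $\nabla$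 is replaced by $\hat\nabla$. The tractor connection is $\nabla_a(V^b,\sigma)=(\nabla_aV^b+\sigma\delta_a{}^b,\ \nabla_a\sigma-P_{ab}V^b)$, extended by the Leibniz rule to weighted tensor powers $\mathcal E^{I_1\dots I_k}(w)$. For a section $f$ of weight $w$ of a tractor bundle put $D_Af=(wf,\nabla_af)$; its contraction with the tractor index of $(V^a,\sigma)$ pairs $wf$ with $\sigma$ and $\nabla_a f$ with $V^a$. For a symmetric tractor $V^{I_1\dots I_k}\in\mathcal E^{(I_1\dots I_k)}(v+k)$ and a connection $\nabla$ in the class, let $V_\alpha^{i_1\dots i_\alpha}\in\mathcal E^{(i_1\dots i_\alpha)}(v)$, $0\le\alpha\le k$, be its components; $V_k$ is independent of $\nabla$, and $V^{I_1\dots I_k}$ is called a lift of $V_k$. Let $k\ge1$ and $v\in\mathbb R$. (1) If $v\notin\{-(n+k+\alpha-1)\}_{\alpha=1,\dots,k}$, then every $V^{i_1\dots i_k}\in\mathcal E^{(i_1\dots i_k)}(v)$ has a unique lift $V^{I_1\dots I_k}\in\mathcal E^{(I_1\dots I_k)}(v+k)$ such that $D_AV^{AI_2\dots I_k}=0$.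 (2) For every $v$, every $V^{I_1\dots I_k}\in\mathcal E^{(I_1\dots I_k)}(v+k)$ and every connection $\nabla$ in the class, $D_AV^{AI_2\dots I_k}=0$ if and only if $$\nabla_aV_\alpha^{ai_1\dots i_{\alpha-1}}+(v+n+k+\alpha-1)V_{\alpha-1}^{i_1\dots i_{\alpha-1}}-(k-\alpha)P_{ab}V_{\alpha+1}^{abi_1\dots i_{\alpha-1}}=0,\qquad \alpha=1,\dots,k$$ (for $\alpha=k$ the last term is absent). (3) If $v=-(n+k+\alpha-1)$ for some $\alpha\in\{1,\dots,k\}$, then there is a projectively invariant differential operator $$\mathcal E^{(i_1\dots i_k)}(v)\to\mathcal E^{(i_1\dots i_{\alpha-1})}(v),\qquad V^{i_1\dots i_k}\mapsto\nabla_{i_1}\cdots\nabla_{i_{k+1-\alpha}}V^{i_1\dots i_k}+\text{curvature correction terms},$$ i.e. this formula gives the same result for all connections $\nabla$ in the class. Here the curvature correction terms are a linear combination, with constant coefficients depending only on $n,k,\alpha$ (and not on $\mathcal M$ or its projective structure), of compositions of the operations $S^{a\dots}\mapsto\nabla_aS^{a\dots}$ and $S^{ab\dots}\mapsto P_{ab}S^{ab\dots}$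 that map valence $k$ to valence $\alpha-1$ and contain the second operation at least once. -/

import Mathlib

open Set
open scoped Manifold ContDiff

noncomputable section

namespace ProjectiveTractor

/-! ## Coordinates

`M` is a smooth `n`-manifold modelled on `ℝⁿ`.  A geometric object on `M` is given by its components
in every chart of the atlas, subject to the classical transformation law on overlaps.  Components in
a chart `e` are functions of the coordinates `x ∈ e.target ⊆ ℝⁿ`. -/

/-- The model space `ℝⁿ`. -/
abbrev Coord (n : ℕ) : Type := EuclideanSpace ℝ (Fin n)

/-- The partial derivative `∂f/∂xᵃ`. -/
def pd {n : ℕ} (f : Coord n → ℝ) (x : Coord n) (a : Fin n) : ℝ :=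
  fderiv ℝ f x (EuclideanSpace.single a 1)

/-- The action of a matrix `g` on components of a contravariant tensor of valence `k`:
`T^{I₁…I_k} ↦ g^{I₁}_{J₁} ⋯ g^{I_k}_{J_k} T^{J₁…J_k}`. -/
def tensorAct {ι : Type} [Fintype ι] {k : ℕ} (g : Matrix ι ι ℝ) (T : (Fin k → ι) → ℝ) :
    (Fin k → ι) → ℝ :=
  fun I => ∑ J : Fin k → ι, (∏ j, g (I j) (J j)) * T J

/-- The covariant derivative `∇ₐ S^{I₁…I_k}` of a tuple `S` of component functions, for the
connection with matrices `A` on each index (`∇ₐ X^I = ∂ₐ X^I + Aₐ^I_C X^C`) and with the additional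
scalar connection form `θ` (which accounts for a density weight). -/
def covDeriv {n : ℕ} {ι : Type} [Fintype ι] (A : Coord n → Fin n → Matrix ι ι ℝ)
    (θ : Coord n → Fin n → ℝ) {k : ℕ} (S : Coord n → (Fin k → ι) → ℝ)
    (x : Coord n) (a : Fin n) (I : Fin k → ι) : ℝ :=
  pd (fun y => S y I) x a
    + ∑ j : Fin k, ∑ c : ι, A x a (I j) c * S x (Function.update I j c)
    + θ x a * S x I

section Manifold

variable (n : ℕ) (M : Type*) [TopologicalSpace M] [ChartedSpace (Coord n) M]

/-- The charts of `M`. -/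
abbrev Chart : Type _ := atlas (Coord n) M

variable {n M}

/-- The change of coordinates from `e` to `e'`. -/
def transition (e e' : Chart n M) : Coord n → Coord n := fun x => e'.1 (e.1.symm x)

/-- The domain of the change of coordinates from `e` to `e'`. -/
def overlap (e e' : Chart n M) : Set (Coord n) := (e.1.symm.trans e'.1).source

/-- The Jacobian matrix `∂x'ⁱ/∂xʲ` of the change of coordinates from `e` to `e'`. -/
def jac (e e' : Chart n M) (x : Coord n) : Matrix (Fin n) (Fin n) ℝ :=
  Matrix.of fun i j => pd (fun y => transition e e' y i) x j

variable (n M)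

/-! ## Projective structures -/

/-- A smooth torsion-free affine connection on `M`, given by its Christoffel symbols:
`Γ e x c a b` is `Γ^c_{ab}` in the chart `e`, where `∇ₐ X^c = ∂ₐ X^c + Γ^c_{ab} X^b`. -/
structure TorsionFreeConnection where
  Γ : Chart n M → Coord n → Fin n → Fin n → Fin n → ℝ
  smooth : ∀ e c a b, ContDiffOn ℝ ∞ (fun x => Γ e x c a b) e.1.target
  transform : ∀ e e', ∀ x ∈ overlap e e', ∀ c a b,
    ∑ d, jac e e' x c d * Γ e x d a b =
      pd (fun y => jac e e' y c b) x a
        + ∑ i, ∑ j, Γ e' (transition e e' x) c i j * jac e e' x i a * jac e e' x j b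
  torsionFree : ∀ e, ∀ x ∈ e.1.target, ∀ c a b, Γ e x c a b = Γ e x c b a

/-- A smooth one-form on `M`. -/
structure OneForm where
  comp : Chart n M → Coord n → Fin n → ℝ
  smooth : ∀ e a, ContDiffOn ℝ ∞ (fun x => comp e x a) e.1.target
  transform : ∀ e e', ∀ x ∈ overlap e e', ∀ a,
    comp e x a = ∑ i, comp e' (transition e e' x) i * jac e e' x i a

variable {n M}

/-- `c : (s, t) → ℝⁿ` is, in the coordinates of the chart `e`, an unparametrized geodesic of `D`:
a regular curve whose acceleration `∇_ċ ċ` is everywhere proportional to `ċ`, i.e. a geodesic up to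
reparametrization. -/
def TorsionFreeConnection.IsUnparametrizedGeodesic (D : TorsionFreeConnection n M)
    (e : Chart n M) (s t : ℝ) (c : ℝ → Coord n) : Prop :=
  ContDiffOn ℝ 2 c (Ioo s t) ∧ MapsTo c (Ioo s t) e.1.target ∧
    ∀ τ ∈ Ioo s t, deriv c τ ≠ 0 ∧ ∃ r : ℝ, ∀ i,
      deriv (deriv c) τ i + ∑ a, ∑ b, D.Γ e (c τ) i a b * deriv c τ a * deriv c τ b
        = r * deriv c τ i

/-- Two connections have the same unparametrized geodesics.  Being an unparametrized geodesic is a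
local property of a curve, so it suffices to compare curves inside coordinate charts. -/
def SameGeodesics (D D' : TorsionFreeConnection n M) : Prop :=
  ∀ e s t c, D.IsUnparametrizedGeodesic e s t c ↔ D'.IsUnparametrizedGeodesic e s t c

variable (n M)

/-- Projective equivalence of torsion-free connections. -/
instance projectiveSetoid : Setoid (TorsionFreeConnection n M) where
  r := SameGeodesics
  iseqv :=
    ⟨fun _ _ _ _ _ => Iff.rfl, fun h e s t c => (h e s t c).symm,
      fun h h' e s t c => (h e s t c).trans (h' e s t c)⟩

/-- A projective structure on `M`: an equivalence class of torsion-free affine connections with the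
same unparametrized geodesics. -/
def ProjectiveStructure : Type _ := Quotient (projectiveSetoid n M)

variable {n M}

/-- The connections in the projective class `p`. -/
def ProjectiveStructure.Connection (p : ProjectiveStructure n M) : Type _ :=
  {D : TorsionFreeConnection n M // (Quotient.mk (projectiveSetoid n M) D : ProjectiveStructure n M) = p}

/-- The connections `D = ∇` and `D' = ∇̂` are related by the one-form `Υ`:
`∇̂ₐ ω_b = ∇ₐ ω_b - Υₐ ω_b - Υ_b ωₐ` for all one-forms `ω`. -/
def IsProjectiveChange (D D' : TorsionFreeConnection n M) (Υ : OneForm n M) : Prop :=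
  ∀ e, ∀ x ∈ e.1.target, ∀ c a b,
    D'.Γ e x c a b = D.Γ e x c a b
      + Υ.comp e x a * (if c = b then 1 else 0) + Υ.comp e x b * (if c = a then 1 else 0)

/-! ## Curvature -/

namespace TorsionFreeConnection

variable (D : TorsionFreeConnection n M) (e : Chart n M) (x : Coord n)

/-- The curvature `R_{ab}{}^c{}_d`, `(∇ₐ∇_b - ∇_b∇ₐ) V^c = R_{ab}{}^c{}_d V^d`. -/
def curvature (a b c d : Fin n) : ℝ :=
  pd (fun y => D.Γ e y c b d) x a - pd (fun y => D.Γ e y c a d) x b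
    + ∑ f, D.Γ e x c a f * D.Γ e x f b d - ∑ f, D.Γ e x c b f * D.Γ e x f a d

/-- The Ricci tensor `R_{ab}{}^a{}_d`. -/
def ricci (b d : Fin n) : ℝ := ∑ a, D.curvature e x a b a d

/-- The Schouten tensor `P_{ab}` (for `n ≥ 2`).  It is obtained by solving the condition that the
Weyl tensor below is trace-free, see `weyl_trace`. -/
def schouten (a b : Fin n) : ℝ :=
  (n * D.ricci e x a b + D.ricci e x b a) / ((n : ℝ) ^ 2 - 1)

/-- The Weyl tensor `C_{ab}{}^c{}_d`, defined by
`R_{ab}{}^c{}_d = C_{ab}{}^c{}_d + δₐ^c P_{bd} - δ_b^c P_{ad} + β_{ab} δ_d^c`, `β_{ab} = -2 P_{[ab]}`. -/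
def weyl (a b c d : Fin n) : ℝ :=
  D.curvature e x a b c d
    - ((if a = c then D.schouten e x b d else 0) - (if b = c then D.schouten e x a d else 0))
    - (D.schouten e x b a - D.schouten e x a b) * (if d = c then 1 else 0)

theorem weyl_trace (hn : 2 ≤ n) (b d : Fin n) : ∑ a, D.weyl e x a b a d = 0 := by
  have h1 : ∑ a, D.weyl e x a b a d
      = D.ricci e x b d - (n * D.schouten e x b d - D.schouten e x b d)
        - (D.schouten e x b d - D.schouten e x d b) := by
    simp [weyl, ricci, Finset.sum_sub_distrib]
  have hn' : (2 : ℝ) ≤ n := by exact_mod_cast hn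
  have h2 : (n : ℝ) ^ 2 - 1 ≠ 0 := by nlinarith
  rw [h1]
  simp only [schouten]
  field_simp
  ring

end TorsionFreeConnection

/-! ## Connection forms -/

/-- The connection matrices `(Aₐ)^c_b = Γ^c_{ab}` of `∇` on vector fields. -/
def affineForm (D : TorsionFreeConnection n M) (e : Chart n M) (x : Coord n) (a : Fin n) :
    Matrix (Fin n) (Fin n) ℝ :=
  Matrix.of fun c b => D.Γ e x c a b

/-- The connection form `(u / (n+1)) Γ^c_{ac}` of `∇` on the density bundle
`ℰ(u) = (Λⁿ)^{-u/(n+1)}`. -/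
def densityForm (D : TorsionFreeConnection n M) (u : ℝ) (e : Chart n M) (x : Coord n) (a : Fin n) :
    ℝ :=
  u / (n + 1) * ∑ c, D.Γ e x c a c

/-! ## Weighted tensors -/

variable (n M)

/-- A smooth section of `ℰ^{i₁…i_k}(u)`, i.e. a contravariant tensor of valence `k` with values in
the densities `ℰ(u) = (Λⁿ)^{-u/(n+1)}` of projective weight `u`.  The absolute value of the Jacobian
determinant is the determinant itself between charts of the same orientation.  The components are
normalised to be zero outside the range of the chart, where they have no meaning. -/
structure WeightedTensorField (k : ℕ) (u : ℝ) where
  comp : Chart n M → Coord n → (Fin k → Fin n) → ℝ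
  smooth : ∀ e i, ContDiffOn ℝ ∞ (fun x => comp e x i) e.1.target
  transform : ∀ e e', ∀ x ∈ overlap e e', ∀ i,
    comp e' (transition e e' x) i =
      |(jac e e' x).det| ^ (u / (n + 1)) * tensorAct (jac e e' x) (comp e x) i
  zero_off : ∀ e x, x ∉ e.1.target → comp e x = 0

/-- A smooth section of `ℰ^{(i₁…i_k)}(u)`. -/
def SymmetricTensorField (k : ℕ) (u : ℝ) : Type _ :=
  {V : WeightedTensorField n M k u //
    ∀ e x (i : Fin k → Fin n) (σ : Equiv.Perm (Fin k)), V.comp e x (i ∘ σ) = V.comp e x i}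

variable {n M}

/-! ## Tractors

A tractor index runs over `Fin n ⊕ Unit`: in `V^A = (V^a, σ)` the value `inl a` denotes the
component `V^a` and `inr ()` the component `σ`. -/

/-- The Jacobian matrix acting on `(V^a, σ)`, up to density factors. -/
def tractorJac (e e' : Chart n M) (x : Coord n) : Matrix (Fin n ⊕ Unit) (Fin n ⊕ Unit) ℝ :=
  Matrix.fromBlocks (jac e e' x) 0 0 1

/-- The matrix of the change of splitting `(V^a, σ) ↦ (V^a, σ - Υₐ V^a)`. -/
def splittingChange (Υ : Fin n → ℝ) : Matrix (Fin n ⊕ Unit) (Fin n ⊕ Unit) ℝ :=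
  Matrix.fromBlocks 1 0 (Matrix.of fun _ a => -Υ a) 1

/-- The matrices of the tractor connection, up to density terms:
`∇ₐ (V^b, σ) = (∇ₐ V^b + σ δₐ^b, ∇ₐ σ - P_{ab} V^b)`. -/
def tractorForm (D : TorsionFreeConnection n M) (e : Chart n M) (x : Coord n) (a : Fin n) :
    Matrix (Fin n ⊕ Unit) (Fin n ⊕ Unit) ℝ :=
  Matrix.fromBlocks (affineForm D e x a) (Matrix.of fun b _ => if a = b then 1 else 0)
    (Matrix.of fun _ b => -D.schouten e x a b) 0

/-- A smooth section of the weighted tractor bundle `ℰ^{I₁…I_k}(w)` of the projective structure `p`.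
Each connection `∇` in the class splits it into components.  As `V^a ∈ ℰ^a(-1)` and `σ ∈ ℰ(-1)` for
`V^A ∈ ℰ^A`, all components of a section of `ℰ^{I₁…I_k}(w)` have density weight `w - k`.  Components
are normalised to be zero outside the range of the chart. -/
structure TractorField (p : ProjectiveStructure n M) (k : ℕ) (w : ℝ) where
  comp : p.Connection → Chart n M → Coord n → (Fin k → Fin n ⊕ Unit) → ℝ
  smooth : ∀ D e I, ContDiffOn ℝ ∞ (fun x => comp D e x I) e.1.target
  transform : ∀ D e e', ∀ x ∈ overlap e e', ∀ I,
    comp D e' (transition e e' x) I =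
      |(jac e e' x).det| ^ ((w - k) / (n + 1)) * tensorAct (tractorJac e e' x) (comp D e x) I
  change : ∀ (D D' : p.Connection) (Υ : OneForm n M), IsProjectiveChange D.1 D'.1 Υ →
    ∀ e, ∀ x ∈ e.1.target, comp D' e x = tensorAct (splittingChange (Υ.comp e x)) (comp D e x)
  zero_off : ∀ D e x, x ∉ e.1.target → comp D e x = 0

namespace TractorField

variable {p : ProjectiveStructure n M} {k : ℕ} {w : ℝ} (T : TractorField p k w)

/-- `T` is a section of `ℰ^{(I₁…I_k)}(w)`. -/
def IsSymmetric : Prop :=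
  ∀ D e x (I : Fin k → Fin n ⊕ Unit) (σ : Equiv.Perm (Fin k)), T.comp D e x (I ∘ σ) = T.comp D e x I

/-- The tractor `D`-operator `D_A T^{I₁…I_k} = (w T^{I₁…I_k}, ∇ₐ T^{I₁…I_k})`, where `∇ₐ` is the
weighted tractor connection, in the splitting given by the connection `D`. -/
def tractorD (D : p.Connection) (e : Chart n M) (x : Coord n) :
    Fin n ⊕ Unit → (Fin k → Fin n ⊕ Unit) → ℝ
  | Sum.inl a, I => covDeriv (tractorForm D.1 e) (densityForm D.1 (w - k) e) (T.comp D e) x a I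
  | Sum.inr _, I => w * T.comp D e x I

/-- `D_A T^{A I₂…I_k} = 0`.  The value of the first entry of `I` is irrelevant, it is replaced by the
summation index. -/
def IsDFree [NeZero k] : Prop :=
  ∀ D e, ∀ x ∈ e.1.target, ∀ I : Fin k → Fin n ⊕ Unit,
    ∑ A : Fin n ⊕ Unit, T.tractorD D e x A (Function.update I 0 A) = 0

/-- `T` is a lift of `V`: the projection `ℰ^{I₁…I_k}(v+k) → ℰ^{i₁…i_k}(v)` maps `T` to `V`. -/
def IsLiftOf {v : ℝ} (T : TractorField p k (v + k)) (V : SymmetricTensorField n M k v) : Prop :=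
  ∀ D e x (i : Fin k → Fin n), T.comp D e x (fun j => Sum.inl (i j)) = V.1.comp e x i

/-- The component `V_α^{i₁…i_α}` of a symmetric tractor in the splitting given by `D`: the first `α`
indices are tangential and the remaining `k - α` indices are in the bottom slot. -/
def slot (D : p.Connection) (e : Chart n M) (α : ℕ) (x : Coord n) (i : Fin α → Fin n) : ℝ :=
  T.comp D e x fun j => if h : j.1 < α then Sum.inl (i ⟨j.1, h⟩) else Sum.inr ()

end TractorField

/-! ## Differential operators in a splitting -/

/-- The divergence `∇ₐ S^{a i₁…i_β}` of a tensor of density weight `u`. -/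
def covDiv (D : TorsionFreeConnection n M) (u : ℝ) (e : Chart n M) {β : ℕ}
    (S : Coord n → (Fin (β + 1) → Fin n) → ℝ) (x : Coord n) (i : Fin β → Fin n) : ℝ :=
  ∑ a, covDeriv (affineForm D e) (densityForm D u e) S x a (Matrix.vecCons a i)

/-- The contraction `P_{ab} S^{ab i₁…i_β}`. -/
def schoutenContract (D : TorsionFreeConnection n M) (e : Chart n M) {β : ℕ}
    (S : Coord n → (Fin (β + 2) → Fin n) → ℝ) (x : Coord n) (i : Fin β → Fin n) : ℝ :=
  ∑ a, ∑ b, D.schouten e x a b * S x (Matrix.vecCons a (Matrix.vecCons b i))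

/-- The iterated divergence `∇_{a₁} ⋯ ∇_{a_m} S^{a₁…a_m i₁…i_β}` (for symmetric `S`). -/
def iterDiv (D : TorsionFreeConnection n M) (u : ℝ) (e : Chart n M) {β : ℕ} :
    (m : ℕ) → (Coord n → (Fin (β + m) → Fin n) → ℝ) → Coord n → (Fin β → Fin n) → ℝ
  | 0, S => S
  | m + 1, S => iterDiv D u e m (covDiv D u e S)

end Manifold

/-- The words in the two letters `∇·` (divergence) and `P·` (contraction with the Schouten tensor)
which turn contravariant tensors of valence `k` into tensors of valence `β`. -/
inductive DiffWord (k : ℕ) : ℕ → Type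
  | nil : DiffWord k k
  | div {β : ℕ} (w : DiffWord k (β + 1)) : DiffWord k β
  | schouten {β : ℕ} (w : DiffWord k (β + 2)) : DiffWord k β

namespace DiffWord

/-- The number of curvature factors in a word. -/
def curvatureDegree {k : ℕ} : {β : ℕ} → DiffWord k β → ℕ
  | _, nil => 0
  | _, div w => w.curvatureDegree
  | _, schouten w => w.curvatureDegree + 1

/-- The differential operator given by a word and a connection, on tensors of density weight `u`. -/
def eval {n : ℕ} {M : Type*} [TopologicalSpace M] [ChartedSpace (Coord n) M]
    (D : TorsionFreeConnection n M) (u : ℝ) (e : Chart n M) {k : ℕ}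
    (S : Coord n → (Fin k → Fin n) → ℝ) :
    {β : ℕ} → DiffWord k β → Coord n → (Fin β → Fin n) → ℝ
  | _, nil => S
  | _, div w => covDiv D u e (eval D u e S w)
  | _, schouten w => schoutenContract D e (eval D u e S w)

end DiffWord

end ProjectiveTractor

end

open ProjectiveTractor

noncomputable section

namespace ProjectiveTractor

/-! ## Partial derivatives -/

section Pd

variable {n : ℕ} {f g : Coord n → ℝ} {x : Coord n}

/-! The contraction `D_A V^{A…}` is a divergence of tractors that does not depend on the splitting,
and in each splitting it is a triangular system for the slots of `V`. Invariance rests on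
`tractorForm_projectiveChange`: the change of splitting intertwines the two tractor connection forms
up to `Υₐ` per index. Here the change `P̂ = P - ∇Υ + ΥΥ` of the Schouten tensor is exactly what is
needed. Densities of weight `v` contribute `vΥₐ`, and the total `(v + k)Υₐ` is compensated by the
change of the bottom component `(v + k)V` of `D_A V` (`tractorDiv_projectiveChange`). A symmetric
tractor is determined by its slots, and `tractorDiv_slotIndex` computes those of the divergence: the
slot of valence `β` is `∇·V_{β+1} + (v+n+k+β) V_β - (k-β-1) P·V_{β+2}`. This gives (2), since
vanishing in one splitting implies vanishing in all.

If no coefficient `v+n+k+β` is zero, the system is solved uniquely downwards from `V_k`. The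
solution found with one connection, carried to another splitting, still has zero divergence; by
uniqueness it is the solution found there. Hence the local solutions form a tractor, which is (1).

For (3) the denominators are cleared. The slots of the solution are `slotFactor` times tensors given
by `tower`, which makes sense at every weight and is `∇⋯∇V` plus terms containing `P`
(`DiffWord.exists_tower_eq`). At the excluded weight with vanishing coefficient in valence `β`, the
slots above `β` are still uniquely determined. Extended by zero they form a tractor whose divergence
has no slot above `β` and has a nonzero multiple of `tower` in valence `β`. The slot of highest
valence of a tractor does not depend on the splitting, so `tower` is invariant
(`tower_projectiveChange`).

Two foundations are needed. Connections with the same unparametrized geodesics differ by a one-form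
(`SameGeodesics.exists_isProjectiveChange`), and all operators are natural under changes of
coordinates. The gauge rule `covDeriv_gauge` serves both coordinate changes and projective changes.
-/

theorem pd_add (hf : DifferentiableAt ℝ f x) (hg : DifferentiableAt ℝ g x) (a : Fin n) :
    pd (fun y => f y + g y) x a = pd f x a + pd g x a := by
  simp [pd, fderiv_fun_add hf hg]

theorem pd_mul (hf : DifferentiableAt ℝ f x) (hg : DifferentiableAt ℝ g x) (a : Fin n) :
    pd (fun y => f y * g y) x a = f x * pd g x a + pd f x a * g x := by
  simp [pd, fderiv_fun_mul hf hg, mul_comm]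

theorem pd_const (c : ℝ) (x : Coord n) (a : Fin n) : pd (fun _ => c) x a = 0 := by
  simp [pd]

theorem pd_const_mul (hf : DifferentiableAt ℝ f x) (c : ℝ) (a : Fin n) :
    pd (fun y => c * f y) x a = c * pd f x a := by
  rw [pd_mul (differentiableAt_const c) hf, pd_const]; ring

theorem pd_neg (f : Coord n → ℝ) (x : Coord n) (a : Fin n) :
    pd (fun y => -f y) x a = -pd f x a := by
  simp [pd, fderiv_fun_neg]

theorem pd_sum {ι : Type*} {s : Finset ι} {F : ι → Coord n → ℝ}
    (h : ∀ i ∈ s, DifferentiableAt ℝ (F i) x) (a : Fin n) :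
    pd (fun y => ∑ i ∈ s, F i y) x a = ∑ i ∈ s, pd (F i) x a := by
  simp [pd, fderiv_fun_sum h]

theorem pd_prod {ι : Type*} [DecidableEq ι] {s : Finset ι} {F : ι → Coord n → ℝ}
    (h : ∀ i ∈ s, DifferentiableAt ℝ (F i) x) (a : Fin n) :
    pd (fun y => ∏ i ∈ s, F i y) x a = ∑ i ∈ s, pd (F i) x a * ∏ j ∈ s.erase i, F j x := by
  have := (HasFDerivAt.finsetProd (u := s) (fun i hi => (h i hi).hasFDerivAt)).fderiv
  simp [pd, this, mul_comm]

theorem pd_congr (h : f =ᶠ[nhds x] g) (a : Fin n) : pd f x a = pd g x a := by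
  simp [pd, h.fderiv_eq]

theorem pd_congr_of_isOpen {s : Set (Coord n)} (hs : IsOpen s) (hx : x ∈ s)
    (h : ∀ y ∈ s, f y = g y) (a : Fin n) : pd f x a = pd g x a :=
  pd_congr (Filter.eventuallyEq_of_mem (hs.mem_nhds hx) h) a

theorem fderiv_apply_eq_sum_pd (f : Coord n → ℝ) (x v : Coord n) :
    fderiv ℝ f x v = ∑ i, v i * pd f x i := by
  have hv : v = ∑ i, v i • EuclideanSpace.single i (1 : ℝ) := by
    ext j; simp [Pi.single_apply]
  conv_lhs => rw [hv]
  simp [pd]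

theorem pd_comp {φ : Coord n → Coord n} (hf : DifferentiableAt ℝ f (φ x))
    (hφ : DifferentiableAt ℝ φ x) (a : Fin n) :
    pd (fun y => f (φ y)) x a = ∑ i, pd f (φ x) i * pd (fun y => φ y i) x a := by
  have h1 : fderiv ℝ (fun y => f (φ y)) x = (fderiv ℝ f (φ x)).comp (fderiv ℝ φ x) :=
    fderiv_comp x hf hφ
  have h2 : ∀ i, pd (fun y => φ y i) x a = fderiv ℝ φ x (EuclideanSpace.single a 1) i := by
    intro i
    have := ((EuclideanSpace.proj (𝕜 := ℝ) i : Coord n →L[ℝ] ℝ).hasFDerivAt.comp x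
      hφ.hasFDerivAt).fderiv
    have h3 : (fun y => φ y i) = (EuclideanSpace.proj (𝕜 := ℝ) i : Coord n →L[ℝ] ℝ) ∘ φ := by
      ext y; simp
    rw [pd, h3, this]; simp
  simp only [h2]
  rw [pd, h1, ContinuousLinearMap.comp_apply, fderiv_apply_eq_sum_pd]
  exact Finset.sum_congr rfl fun i _ => mul_comm _ _

theorem contDiffOn_pd {s : Set (Coord n)} (hs : IsOpen s) (hf : ContDiffOn ℝ ∞ f s) (a : Fin n) :
    ContDiffOn ℝ ∞ (fun y => pd f y a) s :=
  (hf.fderiv_of_isOpen hs (by simp)).clm_apply contDiffOn_const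

theorem pd_pd_comm (hf : ContDiffAt ℝ 2 f x) (a b : Fin n) :
    pd (fun y => pd f y a) x b = pd (fun y => pd f y b) x a := by
  have hd : DifferentiableAt ℝ (fderiv ℝ f) x :=
    (hf.fderiv_right (m := 1) (by norm_num)).differentiableAt one_ne_zero
  have h : ∀ a b : Fin n, pd (fun y => pd f y a) x b
      = fderiv ℝ (fderiv ℝ f) x (EuclideanSpace.single b 1) (EuclideanSpace.single a 1) := by
    intro a b
    simp only [pd]
    rw [fderiv_clm_apply hd (differentiableAt_const _)]
    simp
  rw [h, h]
  exact (hf.isSymmSndFDerivAt (by simp)).eq _ _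

theorem differentiableAt_of_contDiffOn {s : Set (Coord n)} (hs : IsOpen s)
    (hf : ContDiffOn ℝ ∞ f s) (hx : x ∈ s) : DifferentiableAt ℝ f x :=
  (hf.contDiffAt (hs.mem_nhds hx)).differentiableAt (by simp)

/-- Jacobi's formula. Differentiating the Leibniz expansion gives a sum of determinants with one
column differentiated, which Cramer's rule identifies as diagonal entries of a product with the
adjugate. -/
theorem pd_det {ι : Type*} [Fintype ι] [DecidableEq ι] {J : Coord n → Matrix ι ι ℝ}
    (h : ∀ i j, DifferentiableAt ℝ (fun y => J y i j) x) (a : Fin n) :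
    pd (fun y => (J y).det) x a
      = ((J x).adjugate * Matrix.of fun i j => pd (fun y => J y i j) x a).trace := by
  have h1 : (fun y => (J y).det)
      = fun y => ∑ σ : Equiv.Perm ι, (σ.sign : ℝ) * ∏ i, J y (σ i) i := by
    ext y; simp [Matrix.det_apply']
  have hp : ∀ σ : Equiv.Perm ι, DifferentiableAt ℝ (fun y => ∏ i, J y (σ i) i) x := fun σ =>
    (HasFDerivAt.finsetProd (fun i _ => (h (σ i) i).hasFDerivAt)).differentiableAt
  rw [h1, pd_sum fun σ _ => (hp σ).const_mul _]
  have h2 : ∀ σ : Equiv.Perm ι, pd (fun y => (σ.sign : ℝ) * ∏ i, J y (σ i) i) x a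
      = ∑ i, (σ.sign : ℝ) * ∏ j, (J x).updateCol i
          (fun c => pd (fun y => J y c i) x a) (σ j) j := by
    intro σ
    rw [pd_const_mul (hp σ), pd_prod fun i _ => h _ _, Finset.mul_sum]
    refine Finset.sum_congr rfl fun i _ => ?_
    rw [← Finset.mul_prod_erase _ _ (Finset.mem_univ i), Matrix.updateCol_self]
    congr 2
    refine Finset.prod_congr rfl fun j hj => ?_
    rw [Matrix.updateCol_ne (Finset.ne_of_mem_erase hj)]
  simp only [h2]
  rw [Finset.sum_comm]
  simp only [← Matrix.det_apply', Matrix.trace, Matrix.diag_apply]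
  refine Finset.sum_congr rfl fun i _ => ?_
  have h3 := congrFun (Matrix.cramer_eq_adjugate_mulVec (J x)
    (fun c => pd (fun y => J y c i) x a)) i
  rw [Matrix.cramer_apply] at h3
  rw [h3, Matrix.mul_apply]
  simp [Matrix.mulVec, dotProduct]

end Pd

/-! ## Changes of coordinates -/

section Charts

variable {n : ℕ} {M : Type*} [TopologicalSpace M] [ChartedSpace (Coord n) M]

theorem isOpen_overlap (e e' : Chart n M) : IsOpen (overlap e e') :=
  (e.1.symm.trans e'.1).open_source

theorem mem_target_of_mem_overlap {e e' : Chart n M} {x : Coord n} (hx : x ∈ overlap e e') :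
    x ∈ e.1.target := by
  have := hx
  simp only [overlap, OpenPartialHomeomorph.trans_source, OpenPartialHomeomorph.symm_source] at this
  exact this.1

theorem transition_mem_overlap {e e' : Chart n M} {x : Coord n} (hx : x ∈ overlap e e') :
    transition e e' x ∈ overlap e' e := by
  simp only [overlap, OpenPartialHomeomorph.trans_source, OpenPartialHomeomorph.symm_source,
    mem_inter_iff, mem_preimage] at hx ⊢
  refine ⟨e'.1.map_source hx.2, ?_⟩
  simp only [transition, e'.1.left_inv hx.2]
  exact e.1.map_target hx.1

theorem transition_mem_target {e e' : Chart n M} {x : Coord n} (hx : x ∈ overlap e e') :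
    transition e e' x ∈ e'.1.target :=
  mem_target_of_mem_overlap (transition_mem_overlap hx)

theorem transition_transition {e e' : Chart n M} {x : Coord n} (hx : x ∈ overlap e e') :
    transition e' e (transition e e' x) = x := by
  simp only [overlap, OpenPartialHomeomorph.trans_source, OpenPartialHomeomorph.symm_source,
    mem_inter_iff, mem_preimage] at hx
  simp only [transition, e'.1.left_inv hx.2, e.1.right_inv hx.1]

variable [IsManifold (𝓡 n) ∞ M]

theorem contDiffOn_transition (e e' : Chart n M) :
    ContDiffOn ℝ ∞ (transition e e') (overlap e e') := by
  have h := (contDiffGroupoid ∞ (𝓡 n)).compatible (M := M) e.2 e'.2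
  rw [contDiffGroupoid, mem_groupoid_of_pregroupoid] at h
  have h2 := h.1
  simp only [contDiffPregroupoid, modelWithCornersSelf_coe, modelWithCornersSelf_coe_symm,
    range_id, preimage_id, inter_univ, Function.comp_def, id] at h2
  exact h2

theorem differentiableAt_transition {e e' : Chart n M} {x : Coord n} (hx : x ∈ overlap e e') :
    DifferentiableAt ℝ (transition e e') x :=
  ((contDiffOn_transition e e').contDiffAt ((isOpen_overlap e e').mem_nhds hx)).differentiableAt
    (by simp)

theorem contDiffOn_transition_apply (e e' : Chart n M) (i : Fin n) :
    ContDiffOn ℝ ∞ (fun y => transition e e' y i) (overlap e e') :=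
  (EuclideanSpace.proj (𝕜 := ℝ) i : Coord n →L[ℝ] ℝ).contDiff.comp_contDiffOn
    (contDiffOn_transition e e')

theorem contDiffOn_jac (e e' : Chart n M) (i j : Fin n) :
    ContDiffOn ℝ ∞ (fun y => jac e e' y i j) (overlap e e') :=
  contDiffOn_pd (isOpen_overlap e e') (contDiffOn_transition_apply e e' i) j

theorem differentiableAt_jac {e e' : Chart n M} {x : Coord n} (hx : x ∈ overlap e e')
    (i j : Fin n) : DifferentiableAt ℝ (fun y => jac e e' y i j) x :=
  differentiableAt_of_contDiffOn (isOpen_overlap e e') (contDiffOn_jac e e' i j) hx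

theorem pd_jac_comm {e e' : Chart n M} {x : Coord n} (hx : x ∈ overlap e e') (c a b : Fin n) :
    pd (fun y => jac e e' y c b) x a = pd (fun y => jac e e' y c a) x b :=
  pd_pd_comm (((contDiffOn_transition_apply e e' c).contDiffAt
    ((isOpen_overlap e e').mem_nhds hx)).of_le (WithTop.coe_le_coe.2 le_top)) b a

theorem pd_comp_transition {e e' : Chart n M} {x : Coord n} (hx : x ∈ overlap e e')
    {f : Coord n → ℝ} (hf : DifferentiableAt ℝ f (transition e e' x)) (a : Fin n) :
    pd (fun y => f (transition e e' y)) x a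
      = ∑ i, pd f (transition e e' x) i * jac e e' x i a :=
  pd_comp hf (differentiableAt_transition hx) a

theorem jac_mul_jac {e e' : Chart n M} {x : Coord n} (hx : x ∈ overlap e e') :
    jac e' e (transition e e' x) * jac e e' x = 1 := by
  ext i j
  have h1 := pd_comp_transition hx (f := fun y => transition e' e y i)
    (differentiableAt_of_contDiffOn (isOpen_overlap e' e) (contDiffOn_transition_apply e' e i)
      (transition_mem_overlap hx)) j
  have h2 : pd (fun y => transition e' e (transition e e' y) i) x j
      = pd (fun y : Coord n => y i) x j :=
    pd_congr_of_isOpen (isOpen_overlap e e') hx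
      (fun y hy => by rw [transition_transition hy]) j
  have h3 : pd (fun y : Coord n => y i) x j = (1 : Matrix (Fin n) (Fin n) ℝ) i j := by
    have : (fun y : Coord n => y i) = (EuclideanSpace.proj (𝕜 := ℝ) i : Coord n →L[ℝ] ℝ) := by
      ext y; simp
    rw [pd, this, ContinuousLinearMap.fderiv]
    simp [Matrix.one_apply]
  rw [Matrix.mul_apply, ← h3, ← h2, h1]
  rfl

theorem det_jac_ne_zero {e e' : Chart n M} {x : Coord n} (hx : x ∈ overlap e e') :
    (jac e e' x).det ≠ 0 := by
  intro h
  have := congrArg Matrix.det (jac_mul_jac hx)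
  rw [Matrix.det_mul, h] at this
  simp at this

theorem jac_mul_jac_right {e e' : Chart n M} {x : Coord n} (hx : x ∈ overlap e e') :
    jac e e' x * jac e' e (transition e e' x) = 1 :=
  mul_eq_one_comm.1 (jac_mul_jac hx)

end Charts

/-! ## Gauge transformations of covariant derivatives -/

section Gauge

variable {n : ℕ} {ι : Type} [Fintype ι] {k : ℕ}

/-- Exchanging the `j`-th entry of `J` with `c` is an involution on the pairs `(J, c)`. -/
theorem sum_update_swap (j : Fin k) (F : (Fin k → ι) → ι → ℝ) :
    ∑ J, ∑ c, F (Function.update J j c) (J j) = ∑ J, ∑ c, F J c := by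
  rw [← Finset.sum_product', ← Finset.sum_product']
  exact Finset.sum_nbij' (fun q => (Function.update q.1 j q.2, q.1 j))
    (fun q => (Function.update q.1 j q.2, q.1 j)) (by simp) (by simp)
    (by simp) (by simp) (by simp)

theorem prod_update_eq {κ : Type} (g : Matrix κ κ ℝ) (I J : Fin k → κ) (j : Fin k) (c : κ) :
    ∏ j', g (Function.update I j c j') (J j')
      = g c (J j) * ∏ j' ∈ Finset.univ.erase j, g (I j') (J j') := by
  rw [← Finset.mul_prod_erase _ _ (Finset.mem_univ j), Function.update_self]
  congr 1
  exact Finset.prod_congr rfl fun j' hj => by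
    rw [Function.update_of_ne (Finset.ne_of_mem_erase hj)]

/-- This and `tensorAct_sum_mul_update` bring a connection matrix acting after, respectively before,
`g` to one normal form, in which the `j`-th factor `g` is replaced by a product. The intertwining
relation can then be applied one index at a time. -/
theorem sum_mul_tensorAct_update (B g : Matrix ι ι ℝ) (S : (Fin k → ι) → ℝ) (I : Fin k → ι) :
    ∑ j, ∑ c, B (I j) c * tensorAct g S (Function.update I j c)
      = ∑ J, (∑ j, (B * g) (I j) (J j) * ∏ j' ∈ Finset.univ.erase j, g (I j') (J j')) * S J := by
  simp only [tensorAct, prod_update_eq, Matrix.mul_apply, Finset.mul_sum, Finset.sum_mul]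
  conv_rhs => rw [Finset.sum_comm]
  refine Finset.sum_congr rfl fun j _ => ?_
  rw [Finset.sum_comm]
  exact Finset.sum_congr rfl fun J _ => Finset.sum_congr rfl fun c _ => by ring

theorem tensorAct_sum_mul_update (B g : Matrix ι ι ℝ) (S : (Fin k → ι) → ℝ) (I : Fin k → ι) :
    tensorAct g (fun J => ∑ j, ∑ c, B (J j) c * S (Function.update J j c)) I
      = ∑ J, (∑ j, (g * B) (I j) (J j) * ∏ j' ∈ Finset.univ.erase j, g (I j') (J j')) * S J := by
  simp only [tensorAct, Matrix.mul_apply, Finset.mul_sum, Finset.sum_mul]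
  rw [Finset.sum_comm]
  conv_rhs => rw [Finset.sum_comm]
  refine Finset.sum_congr rfl fun j _ => ?_
  rw [← sum_update_swap j]
  refine Finset.sum_congr rfl fun J _ => Finset.sum_congr rfl fun c _ => ?_
  rw [← Finset.mul_prod_erase _ _ (Finset.mem_univ j), Function.update_self]
  have : ∏ j' ∈ Finset.univ.erase j, g (I j') (Function.update J j c j')
      = ∏ j' ∈ Finset.univ.erase j, g (I j') (J j') :=
    Finset.prod_congr rfl fun j' hj => by
      rw [Function.update_of_ne (Finset.ne_of_mem_erase hj)]
  rw [this, Function.update_idem, Function.update_eq_self]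
  ring

theorem differentiableAt_tensorAct {x : Coord n} {g : Coord n → Matrix ι ι ℝ}
    {S : Coord n → (Fin k → ι) → ℝ} (hg : ∀ i j, DifferentiableAt ℝ (fun y => g y i j) x)
    (hS : ∀ J, DifferentiableAt ℝ (fun y => S y J) x) (I : Fin k → ι) :
    DifferentiableAt ℝ (fun y => tensorAct (g y) (S y) I) x :=
  DifferentiableAt.fun_sum fun J _ => DifferentiableAt.mul
    (HasFDerivAt.finsetProd (fun j _ => (hg (I j) (J j)).hasFDerivAt)).differentiableAt (hS J)

/-- Covariance of the covariant derivative under the gauge transformation `T = l · g · S`. -/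
theorem covDeriv_gauge {A A' : Coord n → Fin n → Matrix ι ι ℝ} {θ θ' : Coord n → Fin n → ℝ}
    {g : Coord n → Matrix ι ι ℝ} {l : Coord n → ℝ} {S T : Coord n → (Fin k → ι) → ℝ}
    {x : Coord n} {a : Fin n} {μ ν : ℝ}
    (hg : ∀ i j, DifferentiableAt ℝ (fun y => g y i j) x) (hl : DifferentiableAt ℝ l x)
    (hS : ∀ J, DifferentiableAt ℝ (fun y => S y J) x)
    (hT : ∀ᶠ y in nhds x, ∀ I, T y I = l y * tensorAct (g y) (S y) I)
    (hA : ∀ i j, pd (fun y => g y i j) x a + (A' x a * g x) i j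
      = (g x * A x a) i j + μ * g x i j)
    (hθ : pd l x a + θ' x a * l x = l x * θ x a + ν * l x) (I : Fin k → ι) :
    covDeriv A' θ' T x a I
      = l x * tensorAct (g x) (covDeriv A θ S x a) I + (k * μ + ν) * T x I := by
  have hT0 := hT.self_of_nhds
  have hprod : ∀ J : Fin k → ι, DifferentiableAt ℝ (fun y => ∏ j, g y (I j) (J j)) x := fun J =>
    (HasFDerivAt.finsetProd (fun j _ => (hg (I j) (J j)).hasFDerivAt)).differentiableAt
  have h1 : pd (fun y => T y I) x a = pd l x a * tensorAct (g x) (S x) I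
      + l x * (∑ J, (∑ j, pd (fun y => g y (I j) (J j)) x a
          * ∏ j' ∈ Finset.univ.erase j, g x (I j') (J j')) * S x J
        + tensorAct (g x) (fun J => pd (fun y => S y J) x a) I) := by
    rw [pd_congr (g := fun y => l y * tensorAct (g y) (S y) I) (hT.mono fun y hy => hy I),
      pd_mul hl (differentiableAt_tensorAct hg hS I), add_comm]
    congr 2
    simp only [tensorAct]
    rw [pd_sum (F := fun J y => (∏ j, g y (I j) (J j)) * S y J) fun J _ => (hprod J).mul (hS J),
      ← Finset.sum_add_distrib]
    refine Finset.sum_congr rfl fun J _ => ?_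
    rw [pd_mul (hprod J) (hS J), pd_prod fun j _ => hg _ _]
    ring
  have h2 : ∑ j, ∑ c, A' x a (I j) c * T x (Function.update I j c)
      = l x * ∑ j, ∑ c, A' x a (I j) c * tensorAct (g x) (S x) (Function.update I j c) := by
    simp only [hT0, Finset.mul_sum]
    exact Finset.sum_congr rfl fun j _ => Finset.sum_congr rfl fun c _ => by ring
  have h3 : tensorAct (g x) (covDeriv A θ S x a) I
      = tensorAct (g x) (fun J => pd (fun y => S y J) x a) I
        + tensorAct (g x) (fun J => ∑ j, ∑ c, A x a (J j) c * S x (Function.update J j c)) I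
        + θ x a * tensorAct (g x) (S x) I := by
    simp only [tensorAct, covDeriv, Finset.mul_sum (Finset.univ : Finset (Fin k → ι)), mul_add,
      ← Finset.sum_add_distrib]
    exact Finset.sum_congr rfl fun J _ => by ring
  -- The relation `hA` is used once for each of the `k` indices, which is the source of the factor
  -- `k * μ`.
  have h4 : ∑ J, (∑ j, pd (fun y => g y (I j) (J j)) x a
          * ∏ j' ∈ Finset.univ.erase j, g x (I j') (J j')) * S x J
      + ∑ J, (∑ j, (A' x a * g x) (I j) (J j)
          * ∏ j' ∈ Finset.univ.erase j, g x (I j') (J j')) * S x J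
      = ∑ J, (∑ j, (g x * A x a) (I j) (J j)
          * ∏ j' ∈ Finset.univ.erase j, g x (I j') (J j')) * S x J
        + k * μ * tensorAct (g x) (S x) I := by
    simp only [tensorAct, Finset.mul_sum (Finset.univ : Finset (Fin k → ι)),
      ← Finset.sum_add_distrib]
    refine Finset.sum_congr rfl fun J _ => ?_
    have hk : (k : ℝ) * μ * ((∏ j, g x (I j) (J j)) * S x J)
        = (∑ j : Fin k, μ * g x (I j) (J j)
            * ∏ j' ∈ Finset.univ.erase j, g x (I j') (J j')) * S x J := by
      simp only [mul_assoc, Finset.mul_prod_erase _ (fun j => g x (I j) (J j)) (Finset.mem_univ _)]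
      simp [mul_assoc]
    rw [hk, ← add_mul, ← add_mul, ← Finset.sum_add_distrib, ← Finset.sum_add_distrib]
    congr 1
    refine Finset.sum_congr rfl fun j _ => ?_
    rw [← add_mul, ← add_mul, hA]
  rw [covDeriv, h1, h2, sum_mul_tensorAct_update, h3, tensorAct_sum_mul_update, hT0]
  linear_combination l x * h4 + tensorAct (g x) (S x) I * hθ

/-- Chain rule for the covariant derivative. -/
theorem covDeriv_comp {A : Coord n → Fin n → Matrix ι ι ℝ} {θ : Coord n → Fin n → ℝ}
    {φ : Coord n → Coord n} {S : Coord n → (Fin k → ι) → ℝ} {x : Coord n}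
    (hφ : DifferentiableAt ℝ φ x) (hS : ∀ J, DifferentiableAt ℝ (fun y => S y J) (φ x))
    (a : Fin n) (I : Fin k → ι) :
    covDeriv (fun y b => ∑ i, pd (fun z => φ z i) y b • A (φ y) i)
        (fun y b => ∑ i, pd (fun z => φ z i) y b * θ (φ y) i) (fun y => S (φ y)) x a I
      = ∑ i, pd (fun z => φ z i) x a * covDeriv A θ S (φ x) i I := by
  simp only [covDeriv, mul_add, Finset.sum_add_distrib]
  rw [pd_comp (hS I) hφ]
  congr 1
  · congr 1
    · exact Finset.sum_congr rfl fun i _ => mul_comm _ _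
    · simp only [Matrix.sum_apply, Matrix.smul_apply, smul_eq_mul, Finset.sum_mul, Finset.mul_sum]
      conv_rhs => rw [Finset.sum_comm]
      refine Finset.sum_congr rfl fun j _ => ?_
      conv_rhs => rw [Finset.sum_comm]
      exact Finset.sum_congr rfl fun c _ => Finset.sum_congr rfl fun i _ => by ring
  · simp only [Finset.sum_mul, mul_assoc]

end Gauge

/-! ## Naturality under changes of coordinates -/

section Naturality

theorem tensorAct_cons {ι : Type} [Fintype ι] {k : ℕ} (g : Matrix ι ι ℝ)
    (T : (Fin (k + 1) → ι) → ℝ) (i : ι) (I : Fin k → ι) :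
    tensorAct g T (Matrix.vecCons i I)
      = ∑ j, g i j * tensorAct g (fun J => T (Matrix.vecCons j J)) I := by
  simp only [tensorAct, Finset.mul_sum]
  rw [← (Fin.consEquiv fun _ => ι).sum_comp, Fintype.sum_prod_type]
  refine Finset.sum_congr rfl fun j _ => Finset.sum_congr rfl fun J _ => ?_
  simp only [Fin.consEquiv_apply, Fin.prod_univ_succ, Matrix.cons_val_zero, Matrix.cons_val_succ,
    Fin.cons_zero, Fin.cons_succ]
  rw [mul_assoc]
  rfl

theorem tensorAct_sum {κ : Type*} {ι : Type} [Fintype ι] {k : ℕ} (g : Matrix ι ι ℝ)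
    (s : Finset κ) (T : κ → (Fin k → ι) → ℝ) (I : Fin k → ι) :
    tensorAct g (fun J => ∑ q ∈ s, T q J) I = ∑ q ∈ s, tensorAct g (T q) I := by
  simp only [tensorAct, Finset.mul_sum]
  rw [Finset.sum_comm]

theorem tensorAct_const_mul {ι : Type} [Fintype ι] {k : ℕ} (g : Matrix ι ι ℝ)
    (c : ℝ) (T : (Fin k → ι) → ℝ) (I : Fin k → ι) :
    tensorAct g (fun J => c * T J) I = c * tensorAct g T I := by
  simp only [tensorAct, Finset.mul_sum]
  exact Finset.sum_congr rfl fun J _ => by ring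

theorem tensorAct_add {ι : Type} [Fintype ι] {k : ℕ} (g : Matrix ι ι ℝ)
    (S T : (Fin k → ι) → ℝ) (I : Fin k → ι) :
    tensorAct g (fun J => S J + T J) I = tensorAct g S I + tensorAct g T I := by
  simp only [tensorAct, mul_add, Finset.sum_add_distrib]

variable {n : ℕ} {M : Type*} [TopologicalSpace M] [ChartedSpace (Coord n) M]

theorem densityForm_eq_trace (D : TorsionFreeConnection n M) (u : ℝ) (e : Chart n M) (x : Coord n)
    (a : Fin n) : densityForm D u e x a = u / (n + 1) * (affineForm D e x a).trace := by
  simp [densityForm, affineForm, Matrix.trace]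

theorem TorsionFreeConnection.differentiableAt_Γ (D : TorsionFreeConnection n M) {e : Chart n M}
    {x : Coord n} (hx : x ∈ e.1.target) (c a b : Fin n) :
    DifferentiableAt ℝ (fun y => D.Γ e y c a b) x :=
  differentiableAt_of_contDiffOn e.1.open_target (D.smooth e c a b) hx

/-- The pullback of the connection matrices of the chart `e'` to the chart `e`. -/
def pullbackForm (D : TorsionFreeConnection n M) (e e' : Chart n M) (x : Coord n) (a : Fin n) :
    Matrix (Fin n) (Fin n) ℝ :=
  ∑ i, jac e e' x i a • affineForm D e' (transition e e' x) i

/-- The transformation law of Christoffel symbols in matrix form `∂J + BJ = JA`, which is hypothesis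
`hA` of `covDeriv_gauge` with `μ = 0`. -/
theorem pd_jac_add_pullbackForm_mul (D : TorsionFreeConnection n M) {e e' : Chart n M}
    {x : Coord n} (hx : x ∈ overlap e e') (a c b : Fin n) :
    pd (fun y => jac e e' y c b) x a + (pullbackForm D e e' x a * jac e e' x) c b
      = (jac e e' x * affineForm D e x a) c b := by
  have h := D.transform e e' x hx c a b
  simp only [Matrix.mul_apply, affineForm, Matrix.of_apply, pullbackForm, Matrix.sum_apply,
    Matrix.smul_apply, smul_eq_mul]
  rw [h]
  congr 1
  simp only [Finset.sum_mul]
  rw [Finset.sum_comm]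
  exact Finset.sum_congr rfl fun i _ => Finset.sum_congr rfl fun j _ => by ring

/-- The factor by which densities of weight `u` are multiplied when the chart `e` is replaced by
`e'`. -/
def densityFactor (u : ℝ) (e e' : Chart n M) (x : Coord n) : ℝ :=
  |(jac e e' x).det| ^ (u / (n + 1))

variable [IsManifold (𝓡 n) ∞ M]

/-- `Real.log` ignores the sign of its argument, so this form can be differentiated without
distinguishing orientations. -/
theorem densityFactor_eq_exp (u : ℝ) {e e' : Chart n M} {x : Coord n} (hx : x ∈ overlap e e') :
    densityFactor u e e' x = Real.exp (Real.log (jac e e' x).det * (u / (n + 1))) := by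
  rw [densityFactor, Real.rpow_def_of_pos (abs_pos.2 (det_jac_ne_zero hx)), Real.log_abs]

theorem differentiableAt_det_jac {e e' : Chart n M} {x : Coord n} (hx : x ∈ overlap e e') :
    DifferentiableAt ℝ (fun y => (jac e e' y).det) x := by
  simp only [Matrix.det_apply']
  exact DifferentiableAt.fun_sum fun σ _ => DifferentiableAt.const_mul
    (HasFDerivAt.finsetProd (fun i _ => (differentiableAt_jac hx (σ i) i).hasFDerivAt)
      ).differentiableAt _

theorem hasFDerivAt_densityFactor (u : ℝ) {e e' : Chart n M} {x : Coord n}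
    (hx : x ∈ overlap e e') :
    HasFDerivAt (densityFactor u e e')
      (densityFactor u e e' x • (u / (n + 1)) • (jac e e' x).det⁻¹ •
        fderiv ℝ (fun y => (jac e e' y).det) x) x := by
  have h1 := ((differentiableAt_det_jac hx).hasFDerivAt.log (det_jac_ne_zero hx)).mul_const
    (u / (n + 1))
  have h2 := h1.exp
  rw [← densityFactor_eq_exp u hx] at h2
  refine h2.congr_of_eventuallyEq ?_
  exact Filter.eventuallyEq_of_mem ((isOpen_overlap e e').mem_nhds hx)
    fun y hy => densityFactor_eq_exp u hy

/-- The trace of `pd_jac_add_pullbackForm_mul`, combined with Jacobi's formula. It provides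
hypothesis `hθ` of `covDeriv_gauge` with `ν = 0`. -/
theorem pd_densityFactor (D : TorsionFreeConnection n M) (u : ℝ) {e e' : Chart n M} {x : Coord n}
    (hx : x ∈ overlap e e') (a : Fin n) :
    pd (densityFactor u e e') x a
        + (∑ i, jac e e' x i a * densityForm D u e' (transition e e' x) i)
          * densityFactor u e e' x
      = densityFactor u e e' x * densityForm D u e x a := by
  have hd := det_jac_ne_zero hx
  have h1 : pd (fun y => (jac e e' y).det) x a
      = (jac e e' x).det * (affineForm D e x a).trace
        - (jac e e' x).det * (pullbackForm D e e' x a).trace := by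
    rw [pd_det fun i j => differentiableAt_jac hx i j]
    have : (Matrix.of fun i j => pd (fun y => jac e e' y i j) x a)
        = jac e e' x * affineForm D e x a - pullbackForm D e e' x a * jac e e' x := by
      ext i j
      rw [Matrix.sub_apply, ← pd_jac_add_pullbackForm_mul D hx]
      simp
    rw [this, mul_sub, Matrix.trace_sub, ← mul_assoc, Matrix.adjugate_mul, ← mul_assoc,
      Matrix.trace_mul_comm (_ * _) (jac e e' x), ← mul_assoc, Matrix.mul_adjugate]
    simp
  have h2 : ∑ i, jac e e' x i a * densityForm D u e' (transition e e' x) i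
      = u / (n + 1) * (pullbackForm D e e' x a).trace := by
    simp only [densityForm_eq_trace, pullbackForm, Matrix.trace_sum, Matrix.trace_smul,
      smul_eq_mul, Finset.mul_sum]
    exact Finset.sum_congr rfl fun i _ => by ring
  have h3 : pd (densityFactor u e e') x a = densityFactor u e e' x * (u / (n + 1)
      * ((jac e e' x).det⁻¹ * pd (fun y => (jac e e' y).det) x a)) := by
    rw [pd, (hasFDerivAt_densityFactor u hx).fderiv]
    rfl
  rw [h3, h2, densityForm_eq_trace, h1, ← mul_sub, inv_mul_cancel_left₀ hd]
  ring

/-- The chain rule pulls the connection of `e'` back along the transition map, and a gauge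
transformation by the Jacobian then turns it into that of `e`. The derivative index is left
contracted with the Jacobian, so no inverse appears yet. -/
theorem covDeriv_chart (D : TorsionFreeConnection n M) (u : ℝ) {e e' : Chart n M} {k : ℕ}
    {S S' : Coord n → (Fin k → Fin n) → ℝ} {x : Coord n} (hx : x ∈ overlap e e')
    (hS : ∀ J, DifferentiableAt ℝ (fun y => S y J) x)
    (hS' : ∀ J, DifferentiableAt ℝ (fun y => S' y J) (transition e e' x))
    (h : ∀ y ∈ overlap e e', ∀ I, S' (transition e e' y) I
      = densityFactor u e e' y * tensorAct (jac e e' y) (S y) I) (a : Fin n) (I : Fin k → Fin n) :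
    ∑ i, jac e e' x i a *
        covDeriv (affineForm D e') (densityForm D u e') S' (transition e e' x) i I
      = densityFactor u e e' x *
        tensorAct (jac e e' x) (covDeriv (affineForm D e) (densityForm D u e) S x a) I := by
  have h1 := covDeriv_comp (A := affineForm D e') (θ := densityForm D u e')
    (differentiableAt_transition hx) hS' a I
  have h2 := covDeriv_gauge (A := affineForm D e) (A' := pullbackForm D e e')
    (θ := densityForm D u e)
    (θ' := fun y b => ∑ i, jac e e' y i b * densityForm D u e' (transition e e' y) i)
    (g := jac e e') (l := densityFactor u e e') (S := S) (T := fun y => S' (transition e e' y))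
    (x := x) (a := a) (μ := 0) (ν := 0) (fun i j => differentiableAt_jac hx i j)
    (hasFDerivAt_densityFactor u hx).differentiableAt hS
    (Filter.eventually_of_mem ((isOpen_overlap e e').mem_nhds hx) h)
    (fun i j => by rw [pd_jac_add_pullbackForm_mul D hx]; simp)
    (by rw [pd_densityFactor D u hx]; simp) I
  simp only [mul_zero, zero_mul, add_zero] at h2
  rw [← h2]
  exact h1.symm

/-- Naturality of the divergence. -/
theorem covDiv_chart (D : TorsionFreeConnection n M) (u : ℝ) {e e' : Chart n M} {k : ℕ}
    {S S' : Coord n → (Fin (k + 1) → Fin n) → ℝ} {x : Coord n} (hx : x ∈ overlap e e')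
    (hS : ∀ J, DifferentiableAt ℝ (fun y => S y J) x)
    (hS' : ∀ J, DifferentiableAt ℝ (fun y => S' y J) (transition e e' x))
    (h : ∀ y ∈ overlap e e', ∀ I, S' (transition e e' y) I
      = densityFactor u e e' y * tensorAct (jac e e' y) (S y) I) (I : Fin k → Fin n) :
    covDiv D u e' S' (transition e e' x) I
      = densityFactor u e e' x * tensorAct (jac e e' x) (covDiv D u e S x) I := by
  set K := jac e' e (transition e e' x)
  have hJK : ∀ i j, ∑ a, jac e e' x i a * K a j = if i = j then 1 else 0 := fun i j => by
    rw [← Matrix.mul_apply, jac_mul_jac_right hx, Matrix.one_apply]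
  have hKJ : ∀ i j, ∑ a, K i a * jac e e' x a j = if i = j then 1 else 0 := fun i j => by
    rw [← Matrix.mul_apply, jac_mul_jac hx, Matrix.one_apply]
  have h1 := covDeriv_chart D u hx hS hS' h
  set Y := covDeriv (affineForm D e) (densityForm D u e) S x
  set Y' := covDeriv (affineForm D e') (densityForm D u e') S' (transition e e' x)
  -- The inverse Jacobian `K` frees the derivative index. In the divergence it then meets the
  -- Jacobian acting on the first tensor index, and the two cancel.
  have h2 : ∀ i I, Y' i I = ∑ a, K a i *
      (densityFactor u e e' x * tensorAct (jac e e' x) (Y a) I) := by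
    intro i I
    simp only [← h1, Finset.mul_sum]
    rw [Finset.sum_comm]
    have : ∀ j, ∑ a, K a i * (jac e e' x j a * Y' j I) = (if j = i then 1 else 0) * Y' j I := by
      intro j
      rw [← hJK, Finset.sum_mul]
      exact Finset.sum_congr rfl fun a _ => by ring
    simp [this]
  have h3 : covDiv D u e' S' (transition e e' x) I = ∑ i, Y' i (Matrix.vecCons i I) := rfl
  have h4 : covDiv D u e S x = fun J => ∑ a, Y a (Matrix.vecCons a J) := rfl
  rw [h3, h4, tensorAct_sum, Finset.mul_sum]
  simp only [h2, tensorAct_cons, Finset.mul_sum]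
  rw [Finset.sum_comm]
  refine Finset.sum_congr rfl fun a _ => ?_
  rw [Finset.sum_comm]
  have : ∀ j, ∑ i, K a i * (densityFactor u e e' x * (jac e e' x i j *
        tensorAct (jac e e' x) (fun J => Y a (Matrix.vecCons j J)) I))
      = (if a = j then 1 else 0) * (densityFactor u e e' x *
        tensorAct (jac e e' x) (fun J => Y a (Matrix.vecCons j J)) I) := by
    intro j
    rw [← hKJ, Finset.sum_mul]
    exact Finset.sum_congr rfl fun i _ => by ring
  simp [this]

end Naturality

/-! ## Naturality of the curvature -/

section CurvatureNaturality

variable {n : ℕ} {M : Type*} [TopologicalSpace M] [ChartedSpace (Coord n) M]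

theorem sum_comm_four {κ : Type*} [Fintype κ] (F : κ → κ → κ → κ → ℝ) :
    ∑ a, ∑ b, ∑ c, ∑ d, F a b c d = ∑ c, ∑ d, ∑ a, ∑ b, F a b c d := by
  calc _ = ∑ q : κ × κ, ∑ r : κ × κ, F q.1 q.2 r.1 r.2 := by simp only [Fintype.sum_prod_type]
    _ = _ := by rw [Finset.sum_comm]; simp only [Fintype.sum_prod_type]

/-- The matrix of the curvature `R_{ab}`. -/
def curvatureMatrix (D : TorsionFreeConnection n M) (e : Chart n M) (x : Coord n) (a b : Fin n) :
    Matrix (Fin n) (Fin n) ℝ :=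
  Matrix.of fun c d => D.curvature e x a b c d

/-- The partial derivative `∂ₐ` of a matrix of functions. -/
def pdMatrix {ι : Type} (A : Coord n → Matrix ι ι ℝ) (x : Coord n) (a : Fin n) : Matrix ι ι ℝ :=
  Matrix.of fun i j => pd (fun y => A y i j) x a

theorem pdMatrix_mul {ι : Type} [Fintype ι] {A B : Coord n → Matrix ι ι ℝ} {x : Coord n}
    (hA : ∀ i j, DifferentiableAt ℝ (fun y => A y i j) x)
    (hB : ∀ i j, DifferentiableAt ℝ (fun y => B y i j) x) (a : Fin n) :
    pdMatrix (fun y => A y * B y) x a = A x * pdMatrix B x a + pdMatrix A x a * B x := by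
  ext i j
  simp only [pdMatrix, Matrix.of_apply, Matrix.mul_apply, Matrix.add_apply]
  rw [pd_sum (F := fun q y => A y i q * B y q j) fun q _ => (hA i q).mul (hB q j),
    ← Finset.sum_add_distrib]
  exact Finset.sum_congr rfl fun q _ => pd_mul (hA i q) (hB q j) a

theorem pdMatrix_add {ι : Type} {A B : Coord n → Matrix ι ι ℝ} {x : Coord n}
    (hA : ∀ i j, DifferentiableAt ℝ (fun y => A y i j) x)
    (hB : ∀ i j, DifferentiableAt ℝ (fun y => B y i j) x) (a : Fin n) :
    pdMatrix (fun y => A y + B y) x a = pdMatrix A x a + pdMatrix B x a := by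
  ext i j
  exact pd_add (hA i j) (hB i j) a

theorem pdMatrix_congr {ι : Type} {A B : Coord n → Matrix ι ι ℝ} {x : Coord n} {s : Set (Coord n)}
    (hs : IsOpen s) (hx : x ∈ s) (h : ∀ y ∈ s, A y = B y) (a : Fin n) :
    pdMatrix A x a = pdMatrix B x a := by
  ext i j
  exact pd_congr_of_isOpen hs hx (fun y hy => by rw [h y hy]) a

theorem curvatureMatrix_eq (D : TorsionFreeConnection n M) (e : Chart n M) (x : Coord n)
    (a b : Fin n) :
    curvatureMatrix D e x a b
      = pdMatrix (fun y => affineForm D e y b) x a - pdMatrix (fun y => affineForm D e y a) x b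
        + affineForm D e x a * affineForm D e x b - affineForm D e x b * affineForm D e x a := by
  ext c d
  simp [curvatureMatrix, TorsionFreeConnection.curvature, pdMatrix, affineForm, Matrix.mul_apply]

variable [IsManifold (𝓡 n) ∞ M]

theorem differentiableAt_affineForm_transition (D : TorsionFreeConnection n M) {e e' : Chart n M}
    {x : Coord n} (hx : x ∈ overlap e e') (a c b : Fin n) :
    DifferentiableAt ℝ (fun y => affineForm D e' (transition e e' y) a c b) x :=
  DifferentiableAt.comp (g := fun y => affineForm D e' y a c b) x
    (D.differentiableAt_Γ (transition_mem_target hx) c a b) (differentiableAt_transition hx)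

theorem differentiableAt_pullbackForm (D : TorsionFreeConnection n M) {e e' : Chart n M}
    {x : Coord n} (hx : x ∈ overlap e e') (a c b : Fin n) :
    DifferentiableAt ℝ (fun y => pullbackForm D e e' y a c b) x := by
  simp only [pullbackForm, Matrix.sum_apply, Matrix.smul_apply, smul_eq_mul]
  exact DifferentiableAt.fun_sum fun i _ =>
    (differentiableAt_jac hx i a).mul (differentiableAt_affineForm_transition D hx i c b)

/-- The curvature of the pulled back connection is the pulled back curvature: the second derivatives
of the transition map are symmetric in `a, b` and drop out. -/
theorem pdMatrix_pullbackForm_sub (D : TorsionFreeConnection n M) {e e' : Chart n M}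
    {x : Coord n} (hx : x ∈ overlap e e') (a b : Fin n) :
    pdMatrix (fun y => pullbackForm D e e' y b) x a
        - pdMatrix (fun y => pullbackForm D e e' y a) x b
        + pullbackForm D e e' x a * pullbackForm D e e' x b
        - pullbackForm D e e' x b * pullbackForm D e e' x a
      = ∑ i, ∑ j, (jac e e' x i a * jac e e' x j b) •
          curvatureMatrix D e' (transition e e' x) i j := by
  have h1 : ∀ a b, pdMatrix (fun y => pullbackForm D e e' y b) x a
      = ∑ j, pd (fun y => jac e e' y j b) x a • affineForm D e' (transition e e' x) j
        + ∑ i, ∑ j, (jac e e' x i a * jac e e' x j b) •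
          pdMatrix (fun y => affineForm D e' y j) (transition e e' x) i := by
    intro a b
    ext c d
    have h2 : pd (fun y => pullbackForm D e e' y b c d) x a
        = ∑ j, pd (fun y => jac e e' y j b * affineForm D e' (transition e e' y) j c d) x a := by
      rw [← pd_sum (F := fun j y => jac e e' y j b * affineForm D e' (transition e e' y) j c d)
        fun j _ => (differentiableAt_jac hx j b).mul
        (differentiableAt_affineForm_transition D hx j c d)]
      simp only [pullbackForm, Matrix.sum_apply, Matrix.smul_apply, smul_eq_mul]
    rw [pdMatrix, Matrix.of_apply, h2]
    simp only [Matrix.add_apply, Matrix.sum_apply, Matrix.smul_apply, smul_eq_mul]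
    rw [Finset.sum_comm (s := Finset.univ) (t := Finset.univ), ← Finset.sum_add_distrib]
    refine Finset.sum_congr rfl fun j _ => ?_
    rw [pd_mul (differentiableAt_jac hx j b) (differentiableAt_affineForm_transition D hx j c d),
      pd_comp_transition hx (f := fun y => affineForm D e' y j c d)
        (D.differentiableAt_Γ (transition_mem_target hx) c j d), add_comm, Finset.mul_sum]
    congr 1
    exact Finset.sum_congr rfl fun i _ => by simp only [pdMatrix, Matrix.of_apply]; ring
  have h3 : ∀ a b, pullbackForm D e e' x a * pullbackForm D e e' x b
      = ∑ i, ∑ j, (jac e e' x i a * jac e e' x j b) •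
        (affineForm D e' (transition e e' x) i * affineForm D e' (transition e e' x) j) := by
    intro a b
    simp only [pullbackForm, Finset.sum_mul_sum, smul_mul_smul_comm]
  have h4 : ∀ F : Fin n → Fin n → Matrix (Fin n) (Fin n) ℝ,
      ∑ i, ∑ j, (jac e e' x i b * jac e e' x j a) • F i j
        = ∑ i, ∑ j, (jac e e' x i a * jac e e' x j b) • F j i := by
    intro F
    rw [Finset.sum_comm]
    exact Finset.sum_congr rfl fun i _ => Finset.sum_congr rfl fun j _ => by rw [mul_comm]
  have h5 : ∀ j, pd (fun y => jac e e' y j b) x a = pd (fun y => jac e e' y j a) x b :=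
    fun j => pd_jac_comm hx j a b
  rw [h1 a b, h1 b a, h3 a b, h3 b a, h4, h4]
  simp only [h5, curvatureMatrix_eq, smul_add, smul_sub, Finset.sum_add_distrib,
    Finset.sum_sub_distrib]
  abel

/-- The integrability condition of `∂J + BJ = JA`: differentiate, antisymmetrize in the two
derivatives, and eliminate first derivatives of `J` with the relation itself. -/
theorem jac_mul_curvatureMatrix (D : TorsionFreeConnection n M) {e e' : Chart n M}
    {x : Coord n} (hx : x ∈ overlap e e') (a b : Fin n) :
    jac e e' x * curvatureMatrix D e x a b
      = (∑ i, ∑ j, (jac e e' x i a * jac e e' x j b) •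
          curvatureMatrix D e' (transition e e' x) i j) * jac e e' x := by
  rw [← pdMatrix_pullbackForm_sub D hx, curvatureMatrix_eq]
  have h1 : ∀ y ∈ overlap e e', ∀ a, pdMatrix (jac e e') y a + pullbackForm D e e' y a * jac e e' y
      = jac e e' y * affineForm D e y a := by
    intro y hy a
    ext c d
    exact pd_jac_add_pullbackForm_mul D hy a c d
  have hJ := differentiableAt_jac hx
  have hJ2 : ∀ a i j, DifferentiableAt ℝ (fun y => pdMatrix (jac e e') y a i j) x := fun a i j =>
    differentiableAt_of_contDiffOn (isOpen_overlap e e')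
      (contDiffOn_pd (isOpen_overlap e e') (contDiffOn_jac e e' i j) a) hx
  have hA : ∀ a i j, DifferentiableAt ℝ (fun y => affineForm D e y a i j) x := fun a i j =>
    D.differentiableAt_Γ (mem_target_of_mem_overlap hx) i a j
  have hB := differentiableAt_pullbackForm D hx
  have h2 : ∀ a b, pdMatrix (fun y => pdMatrix (jac e e') y b) x a
      + (pullbackForm D e e' x b * pdMatrix (jac e e') x a
        + pdMatrix (fun y => pullbackForm D e e' y b) x a * jac e e' x)
      = jac e e' x * pdMatrix (fun y => affineForm D e y b) x a
        + pdMatrix (jac e e') x a * affineForm D e x b := by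
    intro a b
    rw [← pdMatrix_mul hJ (hA b), ← pdMatrix_mul (hB b) hJ, ← pdMatrix_add (hJ2 b)]
    · exact pdMatrix_congr (isOpen_overlap e e') hx (fun y hy => h1 y hy b) a
    · intro i j
      simp only [Matrix.mul_apply]
      exact DifferentiableAt.fun_sum fun q _ => (hB b i q).mul (hJ q j)
  have h3 : pdMatrix (fun y => pdMatrix (jac e e') y b) x a
      = pdMatrix (fun y => pdMatrix (jac e e') y a) x b := by
    ext i j
    exact pd_pd_comm (((contDiffOn_jac e e' i j).contDiffAt
      ((isOpen_overlap e e').mem_nhds hx)).of_le (WithTop.coe_le_coe.2 le_top)) b a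
  have h4 := h2 a b
  have h5 := h2 b a
  have h6 := h1 x hx a
  have h7 := h1 x hx b
  rw [h3] at h4
  generalize pdMatrix (fun y => pdMatrix (jac e e') y a) x b = ddJ at *
  generalize pullbackForm D e e' x a = Ba at *
  generalize pullbackForm D e e' x b = Bb at *
  generalize affineForm D e x a = Aa at *
  generalize affineForm D e x b = Ab at *
  generalize jac e e' x = J at *
  linear_combination (norm := noncomm_ring) h5 - h4 - h6 * Ab + h7 * Aa + Bb * h6 - Ba * h7

theorem ricci_chart (D : TorsionFreeConnection n M) {e e' : Chart n M}
    {x : Coord n} (hx : x ∈ overlap e e') (b d : Fin n) :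
    D.ricci e x b d = ∑ j, ∑ g, jac e e' x j b * jac e e' x g d *
      D.ricci e' (transition e e' x) j g := by
  set K := jac e' e (transition e e' x)
  have hJK : ∀ i j, ∑ a, jac e e' x i a * K a j = if i = j then 1 else 0 := fun i j => by
    rw [← Matrix.mul_apply, jac_mul_jac_right hx, Matrix.one_apply]
  have h1 : ∀ a, curvatureMatrix D e x a b
      = K * ((∑ i, ∑ j, (jac e e' x i a * jac e e' x j b) •
          curvatureMatrix D e' (transition e e' x) i j) * jac e e' x) := by
    intro a
    rw [← jac_mul_curvatureMatrix D hx, ← mul_assoc, jac_mul_jac hx, one_mul]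
  have h2 : D.ricci e x b d = ∑ a, curvatureMatrix D e x a b a d := rfl
  have h3 : ∀ a, curvatureMatrix D e x a b a d = ∑ i, ∑ c, (jac e e' x i a * K a c) *
      ∑ j, ∑ g, jac e e' x j b * jac e e' x g d *
        D.curvature e' (transition e e' x) i j c g := by
    intro a
    rw [h1]
    simp only [Matrix.mul_apply, Matrix.sum_apply, Matrix.smul_apply, smul_eq_mul, Finset.mul_sum,
      Finset.sum_mul, curvatureMatrix, Matrix.of_apply]
    conv_rhs => rw [Finset.sum_comm]
    exact Finset.sum_congr rfl fun c _ => Finset.sum_congr rfl fun i _ =>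
      Finset.sum_congr rfl fun j _ => Finset.sum_congr rfl fun g _ => by ring
  rw [h2]
  simp only [h3]
  rw [Finset.sum_comm]
  have h4 : ∀ i, ∑ a, ∑ c, (jac e e' x i a * K a c) *
      ∑ j, ∑ g, jac e e' x j b * jac e e' x g d *
        D.curvature e' (transition e e' x) i j c g
      = ∑ j, ∑ g, jac e e' x j b * jac e e' x g d *
        D.curvature e' (transition e e' x) i j i g := by
    intro i
    rw [Finset.sum_comm]
    simp only [← Finset.sum_mul, hJK]
    simp
  simp only [h4]
  simp only [TorsionFreeConnection.ricci, Finset.mul_sum]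
  rw [Finset.sum_comm]
  exact Finset.sum_congr rfl fun j _ => Finset.sum_comm

theorem schouten_chart (D : TorsionFreeConnection n M) {e e' : Chart n M}
    {x : Coord n} (hx : x ∈ overlap e e') (b d : Fin n) :
    D.schouten e x b d = ∑ j, ∑ g, jac e e' x j b * jac e e' x g d *
      D.schouten e' (transition e e' x) j g := by
  have h1 : D.ricci e x d b = ∑ j, ∑ g, jac e e' x j b * jac e e' x g d *
      D.ricci e' (transition e e' x) g j := by
    rw [ricci_chart D hx, Finset.sum_comm]
    exact Finset.sum_congr rfl fun i _ => Finset.sum_congr rfl fun j _ => by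
      rw [mul_comm (jac e e' x j d)]
  simp only [TorsionFreeConnection.schouten]
  rw [h1, ricci_chart D hx b d]
  simp only [Finset.mul_sum, ← Finset.sum_add_distrib, Finset.sum_div]
  exact Finset.sum_congr rfl fun i _ => Finset.sum_congr rfl fun j _ => by ring

/-- Naturality of the contraction with the Schouten tensor. -/
theorem schoutenContract_chart (D : TorsionFreeConnection n M) {e e' : Chart n M} {k : ℕ} {l : ℝ}
    {S S' : Coord n → (Fin (k + 2) → Fin n) → ℝ} {x : Coord n} (hx : x ∈ overlap e e')
    (h : ∀ I, S' (transition e e' x) I = l * tensorAct (jac e e' x) (S x) I) (I : Fin k → Fin n) :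
    schoutenContract D e' S' (transition e e' x) I
      = l * tensorAct (jac e e' x) (schoutenContract D e S x) I := by
  have h1 : schoutenContract D e S x = fun J => ∑ b, ∑ d, D.schouten e x b d *
      S x (Matrix.vecCons b (Matrix.vecCons d J)) := rfl
  rw [h1, tensorAct_sum]
  simp only [tensorAct_sum, tensorAct_const_mul, schoutenContract, h, tensorAct_cons,
    schouten_chart D hx, Finset.mul_sum, Finset.sum_mul]
  rw [sum_comm_four]
  exact Finset.sum_congr rfl fun i _ => Finset.sum_congr rfl fun j _ =>
    Finset.sum_congr rfl fun p _ => Finset.sum_congr rfl fun q _ => by ring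

end CurvatureNaturality

/-! ## Projective changes -/

section ProjectiveChange

variable {n : ℕ} {M : Type*} [TopologicalSpace M] [ChartedSpace (Coord n) M]

theorem OneForm.differentiableAt_comp (Υ : OneForm n M) {e : Chart n M} {x : Coord n}
    (hx : x ∈ e.1.target) (a : Fin n) : DifferentiableAt ℝ (fun y => Υ.comp e y a) x :=
  differentiableAt_of_contDiffOn e.1.open_target (Υ.smooth e a) hx

theorem pd_Γ_projectiveChange {D D' : TorsionFreeConnection n M} {Υ : OneForm n M}
    (h : IsProjectiveChange D D' Υ) {e : Chart n M} {x : Coord n} (hx : x ∈ e.1.target)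
    (c a b f : Fin n) :
    pd (fun y => D'.Γ e y c a b) x f = pd (fun y => D.Γ e y c a b) x f
      + pd (fun y => Υ.comp e y a) x f * (if c = b then 1 else 0)
      + pd (fun y => Υ.comp e y b) x f * (if c = a then 1 else 0) := by
  have hU := fun a => Υ.differentiableAt_comp hx a
  rw [pd_congr_of_isOpen e.1.open_target hx (fun y hy => h e y hy c a b) f,
    pd_add ((D.differentiableAt_Γ hx c a b).fun_add ((hU a).mul_const _)) ((hU b).mul_const _),
    pd_add (D.differentiableAt_Γ hx c a b) ((hU a).mul_const _),
    pd_mul (hU a) (differentiableAt_const _), pd_mul (hU b) (differentiableAt_const _),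
    pd_const, pd_const]
  ring

/-- The change of the Ricci tensor under a projective change of connection. -/
theorem ricci_projectiveChange {D D' : TorsionFreeConnection n M} {Υ : OneForm n M}
    (h : IsProjectiveChange D D' Υ) {e : Chart n M} {x : Coord n} (hx : x ∈ e.1.target)
    (b d : Fin n) :
    D'.ricci e x b d = D.ricci e x b d + pd (fun y => Υ.comp e y b) x d
      - n * pd (fun y => Υ.comp e y d) x b + (n - 1) * ∑ f, Υ.comp e x f * D.Γ e x f b d
      + (n - 1) * (Υ.comp e x b * Υ.comp e x d) := by
  have hs := D.torsionFree e x hx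
  simp only [TorsionFreeConnection.ricci, TorsionFreeConnection.curvature,
    pd_Γ_projectiveChange h hx]
  simp only [h e x hx]
  simp only [add_mul, mul_add, mul_ite, ite_mul, mul_one, mul_zero, zero_mul,
    Finset.sum_add_distrib, Finset.sum_sub_distrib, Finset.sum_ite_eq, Finset.sum_ite_eq',
    Finset.mem_univ, if_true]
  simp only [Finset.sum_const, Finset.card_univ, Fintype.card_fin, nsmul_eq_mul]
  have h1 : (∑ f, ∑ g, if f = b then Υ.comp e x g * D.Γ e x g f d else 0)
      = ∑ f, Υ.comp e x f * D.Γ e x f b d := by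
    rw [Finset.sum_comm]; simp
  have h2 : ∑ f, D.Γ e x f b d * Υ.comp e x f = ∑ f, Υ.comp e x f * D.Γ e x f b d :=
    Finset.sum_congr rfl fun f _ => mul_comm _ _
  have h3 : ∑ f, D.Γ e x f b f * Υ.comp e x d = ∑ f, D.Γ e x f f b * Υ.comp e x d :=
    Finset.sum_congr rfl fun f _ => by rw [hs f b f]
  rw [h1, h2, h3]
  simp only [← Finset.mul_sum, ← Finset.sum_mul]
  ring

/-- The change of the Schouten tensor: `P̂_{ab} = P_{ab} - ∇ₐ Υ_b + Υₐ Υ_b`. -/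
theorem schouten_projectiveChange (hn : 2 ≤ n) {D D' : TorsionFreeConnection n M} {Υ : OneForm n M}
    (h : IsProjectiveChange D D' Υ) {e : Chart n M} {x : Coord n} (hx : x ∈ e.1.target)
    (a b : Fin n) :
    D'.schouten e x a b = D.schouten e x a b
      - (pd (fun y => Υ.comp e y b) x a - ∑ f, Υ.comp e x f * D.Γ e x f a b)
      + Υ.comp e x a * Υ.comp e x b := by
  have hn' : (2 : ℝ) ≤ n := by exact_mod_cast hn
  have h2 : (n : ℝ) ^ 2 - 1 ≠ 0 := by nlinarith
  have h3 : ∑ f, Υ.comp e x f * D.Γ e x f b a = ∑ f, Υ.comp e x f * D.Γ e x f a b :=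
    Finset.sum_congr rfl fun f _ => by rw [D.torsionFree e x hx]
  -- In `n Ric_{ab} + Ric_{ba}` the derivatives `∂_b Υₐ` cancel and `∂ₐ Υ_b` receives the factor
  -- `-(n² - 1)`, which the normalisation of `P` removes.
  simp only [TorsionFreeConnection.schouten, ricci_projectiveChange h hx, h3]
  field_simp
  ring

/-- The trace `Γ^c_{ac}` changes by `(n + 1)Υₐ`, which explains the factor `u / (n + 1)`. -/
theorem densityForm_projectiveChange {D D' : TorsionFreeConnection n M} {Υ : OneForm n M}
    (h : IsProjectiveChange D D' Υ) (u : ℝ) {e : Chart n M} {x : Coord n} (hx : x ∈ e.1.target)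
    (a : Fin n) :
    densityForm D' u e x a = densityForm D u e x a + u * Υ.comp e x a := by
  have hn : (n : ℝ) + 1 ≠ 0 := by positivity
  simp only [densityForm, h e x hx, Finset.sum_add_distrib]
  simp
  field_simp
  ring

/-- The matrices of the change of splitting intertwine the tractor connections of `D` and `D'`, up
to a density term. -/
theorem tractorForm_projectiveChange (hn : 2 ≤ n) {D D' : TorsionFreeConnection n M}
    {Υ : OneForm n M} (h : IsProjectiveChange D D' Υ) {e : Chart n M} {x : Coord n}
    (hx : x ∈ e.1.target) (a : Fin n) (i j : Fin n ⊕ Unit) :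
    pd (fun y => splittingChange (Υ.comp e y) i j) x a
        + (tractorForm D' e x a * splittingChange (Υ.comp e x)) i j
      = (splittingChange (Υ.comp e x) * tractorForm D e x a) i j
        + Υ.comp e x a * splittingChange (Υ.comp e x) i j := by
  simp only [tractorForm, splittingChange, Matrix.fromBlocks_multiply]
  rcases i with i | i <;> rcases j with j | j <;>
    simp [affineForm, Matrix.mul_apply, pd_const, pd_neg, h e x hx,
      schouten_projectiveChange hn h hx, Matrix.one_apply]
  · simp only [eq_comm (a := a)]
    ring
  · ring

end ProjectiveChange

/-! ## Symmetric functions of several indices -/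

section Symmetric

/-- A function of `k` indices is symmetric. -/
def IsSymm {ι : Type} {k : ℕ} (T : (Fin k → ι) → ℝ) : Prop :=
  ∀ (I : Fin k → ι) (σ : Equiv.Perm (Fin k)), T (I ∘ σ) = T I

/-- The multiset of values of a family of indices. -/
def values {ι : Type} {k : ℕ} (I : Fin k → ι) : Multiset ι :=
  (Finset.univ : Finset (Fin k)).val.map I

variable {ι : Type} {k : ℕ}

@[simp] theorem card_values (I : Fin k → ι) : (values I).card = k := by simp [values]

theorem values_comp (I : Fin k → ι) (σ : Equiv.Perm (Fin k)) : values (I ∘ σ) = values I := by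
  have := Multiset.map_univ_val_equiv σ
  rw [values, ← Multiset.map_map, this]
  rfl

/-- Equal multiplicities give bijections between the fibres of `I` and `J`, which glue to a
permutation. Consequently a symmetric function depends only on the multiset of its indices. -/
theorem exists_perm_of_values_eq {I J : Fin k → ι} (h : values I = values J) :
    ∃ σ : Equiv.Perm (Fin k), I = J ∘ σ := by
  classical
  have hc : ∀ (K : Fin k → ι) c, (values K).count c = Fintype.card {j // K j = c} := by
    intro K c
    rw [values, Multiset.count_map, Fintype.card_subtype]
    simp only [eq_comm (a := c)]
    rfl
  have e : ∀ c, Nonempty ({j // I j = c} ≃ {j // J j = c}) := fun c =>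
    ⟨Fintype.equivOfCardEq (by rw [← hc, ← hc, h])⟩
  exact ⟨Equiv.ofFiberEquiv fun c => (e c).some, funext fun j => (Equiv.ofFiberEquiv_map _ j).symm⟩

theorem IsSymm.congr_values {T : (Fin k → ι) → ℝ} (hT : IsSymm T) {I J : Fin k → ι}
    (h : values I = values J) : T I = T J := by
  obtain ⟨σ, rfl⟩ := exists_perm_of_values_eq h
  exact hT J σ

theorem values_cons (i : ι) (I : Fin k → ι) : values (Matrix.vecCons i I) = i ::ₘ values I := by
  simp only [values, Fin.univ_val_map, List.ofFn_succ, Matrix.cons_val_zero, Matrix.cons_val_succ,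
    Multiset.cons_coe]

@[simp] theorem values_zero (I : Fin 0 → ι) : values I = 0 := by simp [values]

theorem values_update (I : Fin k → ι) (j : Fin k) (c : ι) :
    I j ::ₘ values (Function.update I j c) = c ::ₘ values I := by
  have h1 : ∀ K : Fin k → ι, values K
      = K j ::ₘ ((Finset.univ.erase j : Finset (Fin k)).val.map K) := by
    intro K
    conv_lhs => rw [values, ← Finset.insert_erase (Finset.mem_univ j)]
    rw [Finset.insert_val_of_notMem (by simp), Multiset.map_cons]
  rw [h1 I, h1 (Function.update I j c), Function.update_self, Multiset.cons_swap]
  congr 2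
  refine Multiset.map_congr rfl fun j' hj' => ?_
  rw [Function.update_of_ne]
  have h2 : j' ∈ Finset.univ.erase j := hj'
  exact Finset.ne_of_mem_erase h2

theorem IsSymm.cons {T : (Fin (k + 1) → ι) → ℝ} (hT : IsSymm T) (i : ι) :
    IsSymm fun I => T (Matrix.vecCons i I) := fun I σ =>
  hT.congr_values (by rw [values_cons, values_cons, values_comp])

theorem IsSymm.tensorAct [Fintype ι] {T : (Fin k → ι) → ℝ} (hT : IsSymm T) (g : Matrix ι ι ℝ) :
    IsSymm (tensorAct g T) := by
  intro I σ
  simp only [ProjectiveTractor.tensorAct]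
  rw [← (Equiv.arrowCongr σ.symm (Equiv.refl ι)).sum_comp]
  refine Finset.sum_congr rfl fun J _ => ?_
  have h1 : (Equiv.arrowCongr σ.symm (Equiv.refl ι)) J = J ∘ σ := by
    ext j; simp [Equiv.arrowCongr]
  rw [h1, hT J σ]
  congr 1
  exact Equiv.prod_comp σ fun j => g (I j) (J j)

/-! ## Slots of symmetric tractors -/

variable {n : ℕ}

/-- The tractor indices `(i₁, …, i_α, 0, …, 0)`. -/
def slotIndex (k : ℕ) {α : ℕ} (i : Fin α → Fin n) : Fin k → Fin n ⊕ Unit :=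
  fun j => if h : j.1 < α then Sum.inl (i ⟨j.1, h⟩) else Sum.inr ()

theorem slotIndex_cons (k : ℕ) {α : ℕ} (a : Fin n) (i : Fin α → Fin n) :
    slotIndex (k + 1) (Matrix.vecCons a i) = Matrix.vecCons (Sum.inl a) (slotIndex k i) := by
  ext j
  refine Fin.cases ?_ (fun j => ?_) j
  · simp [slotIndex]
  · by_cases h : j.1 < α
    · have h' : j.succ.1 < α + 1 := by simpa using h
      simp only [slotIndex, h', dif_pos, Matrix.cons_val_succ, h]
      rfl
    · have h' : ¬ j.succ.1 < α + 1 := by simpa using h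
      simp only [slotIndex, h', Matrix.cons_val_succ, h, dif_neg, not_false_eq_true]

theorem slotIndex_succ_zero (k : ℕ) (i : Fin 0 → Fin n) :
    slotIndex (k + 1) i = Matrix.vecCons (Sum.inr ()) (slotIndex k i) := by
  ext j
  refine Fin.cases ?_ (fun j => ?_) j <;> simp [slotIndex]

theorem values_slotIndex : ∀ {k α : ℕ} (_ : α ≤ k) (i : Fin α → Fin n),
    values (slotIndex k i) = (values i).map Sum.inl + Multiset.replicate (k - α) (Sum.inr ())
  | 0, 0, _, i => by simp
  | k + 1, 0, _, i => by
    rw [slotIndex_succ_zero, values_cons, values_slotIndex (Nat.zero_le k) i]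
    simp [Multiset.replicate_succ]
  | k + 1, α + 1, h, i => by
    have h1 : i = Matrix.vecCons (i 0) (Fin.tail i) := (Fin.cons_self_tail i).symm
    rw [h1, slotIndex_cons, values_cons, values_cons, values_slotIndex (Nat.le_of_succ_le_succ h)]
    simp

theorem values_inr_cons_slotIndex {k α : ℕ} (h : α ≤ k) (i : Fin α → Fin n) :
    values (Matrix.vecCons (Sum.inr ()) (slotIndex k i)) = values (slotIndex (k + 1) i) := by
  rw [values_cons, values_slotIndex h, values_slotIndex (Nat.le_succ_of_le h), Nat.succ_sub h,
    Multiset.replicate_succ, Multiset.add_cons]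

/-- The entries are sorted one by one, with tangential entries put in front and bottom entries
absorbed into the tail. -/
theorem exists_slotIndex (I : Fin k → Fin n ⊕ Unit) :
    ∃ α ≤ k, ∃ i : Fin α → Fin n, values I = values (slotIndex k i) := by
  induction k with
  | zero => exact ⟨0, le_rfl, Fin.elim0, by simp⟩
  | succ k ih =>
    obtain ⟨α, hα, i, hi⟩ := ih (Fin.tail I)
    have h1 : I = Matrix.vecCons (I 0) (Fin.tail I) := (Fin.cons_self_tail I).symm
    rcases h0 : I 0 with a | a
    · refine ⟨α + 1, by omega, Matrix.vecCons a i, ?_⟩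
      rw [h1, values_cons, hi, h0, slotIndex_cons, values_cons]
    · refine ⟨α, by omega, i, ?_⟩
      rw [h1, values_cons, hi, h0, ← values_inr_cons_slotIndex hα, values_cons]

/-- Symmetric tractors are determined by their slots. -/
theorem IsSymm.eq_of_slots {S T : (Fin k → Fin n ⊕ Unit) → ℝ} (hS : IsSymm S) (hT : IsSymm T)
    (h : ∀ α ≤ k, ∀ i : Fin α → Fin n, S (slotIndex k i) = T (slotIndex k i)) : S = T := by
  ext I
  obtain ⟨α, hα, i, hi⟩ := exists_slotIndex I
  rw [hS.congr_values hi, hT.congr_values hi, h α hα i]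

/-- The values of a family of symmetric functions on a multiset of indices. -/
def onMultiset (U : ∀ γ : ℕ, (Fin γ → Fin n) → ℝ) (A : Multiset (Fin n)) : ℝ :=
  U A.toList.length A.toList.get

/-- The arbitrary ordering chosen by `toList` is harmless because `U γ` is symmetric. -/
theorem onMultiset_values {U : ∀ γ : ℕ, (Fin γ → Fin n) → ℝ} {γ : ℕ} (hU : IsSymm (U γ))
    (i : Fin γ → Fin n) : onMultiset U (values i) = U γ i := by
  have h : ∀ l : List (Fin n), (l : Multiset (Fin n)) = values i → U l.length l.get = U γ i := by
    intro l hl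
    have h1 : l.length = γ := by
      have := congrArg Multiset.card hl
      simpa using this
    subst h1
    refine hU.congr_values ?_
    rw [← hl, values, Fin.univ_val_map, List.ofFn_get]
  exact h _ (Multiset.coe_toList _)

/-- The symmetric tractor with given slots. -/
def ofSlots (k : ℕ) (U : ∀ γ : ℕ, (Fin γ → Fin n) → ℝ) (I : Fin k → Fin n ⊕ Unit) : ℝ :=
  onMultiset U ((values I).filterMap Sum.getLeft?)

theorem isSymm_ofSlots (k : ℕ) (U : ∀ γ : ℕ, (Fin γ → Fin n) → ℝ) : IsSymm (ofSlots k U) :=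
  fun I σ => by rw [ofSlots, values_comp, ofSlots]

theorem ofSlots_slotIndex {U : ∀ γ : ℕ, (Fin γ → Fin n) → ℝ} {k γ : ℕ} (h : γ ≤ k)
    (hU : IsSymm (U γ)) (i : Fin γ → Fin n) : ofSlots k U (slotIndex k i) = U γ i := by
  rw [← onMultiset_values hU, ofSlots, values_slotIndex h, Multiset.filterMap_add,
    Multiset.filterMap_map]
  have h1 : (Sum.getLeft? ∘ (Sum.inl : Fin n → Fin n ⊕ Unit)) = some := by ext a; simp
  have h2 : ∀ m, Multiset.filterMap (Sum.getLeft? (α := Fin n))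
      (Multiset.replicate m (Sum.inr ())) = 0 := by
    intro m
    induction m with
    | zero => simp
    | succ m ih => rw [Multiset.replicate_succ, Multiset.filterMap_cons_none _ _ (by simp), ih]
  rw [h1, h2, Multiset.filterMap_some, add_zero]

/-- Every component of `ofSlots k U` is a component of `U`. -/
theorem exists_ofSlots_eq (k : ℕ) (I : Fin k → Fin n ⊕ Unit) :
    ∃ γ ≤ k, ∃ i : Fin γ → Fin n, ∀ U : ∀ γ : ℕ, (Fin γ → Fin n) → ℝ, ofSlots k U I = U γ i := by
  refine ⟨_, ?_, _, fun U => rfl⟩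
  rw [Multiset.length_toList]
  rw [values, Fin.univ_val_map, Multiset.filterMap_coe, Multiset.coe_card]
  exact (List.length_filterMap_le _ _).trans (by simp)

end Symmetric

/-! ## The divergence of a tractor -/

section TractorDivergence

variable {n : ℕ} {M : Type*} [TopologicalSpace M] [ChartedSpace (Coord n) M]

/-- The contraction `D_A T^{A I₁…I_k}` for a tractor whose components have density weight `v`. -/
def tractorDiv (D : TorsionFreeConnection n M) (v : ℝ) (e : Chart n M) {k : ℕ}
    (T : Coord n → (Fin (k + 1) → Fin n ⊕ Unit) → ℝ) (x : Coord n) (I : Fin k → Fin n ⊕ Unit) : ℝ :=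
  ∑ a, covDeriv (tractorForm D e) (densityForm D v e) T x a (Matrix.vecCons (Sum.inl a) I)
    + (v + (k + 1)) * T x (Matrix.vecCons (Sum.inr ()) I)

theorem tensorAct_splittingChange_inl {k : ℕ} (Υ : Fin n → ℝ)
    (T : (Fin (k + 1) → Fin n ⊕ Unit) → ℝ) (a : Fin n) (I : Fin k → Fin n ⊕ Unit) :
    tensorAct (splittingChange Υ) T (Matrix.vecCons (Sum.inl a) I)
      = tensorAct (splittingChange Υ) (fun J => T (Matrix.vecCons (Sum.inl a) J)) I := by
  rw [tensorAct_cons, Fintype.sum_sum_type]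
  simp [splittingChange, Matrix.one_apply]

theorem tensorAct_splittingChange_inr {k : ℕ} (Υ : Fin n → ℝ)
    (T : (Fin (k + 1) → Fin n ⊕ Unit) → ℝ) (I : Fin k → Fin n ⊕ Unit) :
    tensorAct (splittingChange Υ) T (Matrix.vecCons (Sum.inr ()) I)
      = tensorAct (splittingChange Υ) (fun J => T (Matrix.vecCons (Sum.inr ()) J)) I
        - ∑ a, Υ a *
          tensorAct (splittingChange Υ) (fun J => T (Matrix.vecCons (Sum.inl a) J)) I := by
  rw [tensorAct_cons, Fintype.sum_sum_type]
  simp [splittingChange, add_comm, sub_eq_add_neg]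

theorem differentiableAt_splittingChange (Υ : OneForm n M) {e : Chart n M} {x : Coord n}
    (hx : x ∈ e.1.target) (i j : Fin n ⊕ Unit) :
    DifferentiableAt ℝ (fun y => splittingChange (Υ.comp e y) i j) x := by
  rcases i with i | i <;> rcases j with j | j <;> simp only [splittingChange,
    Matrix.fromBlocks_apply₁₁, Matrix.fromBlocks_apply₁₂, Matrix.fromBlocks_apply₂₁,
    Matrix.fromBlocks_apply₂₂, Matrix.of_apply, differentiableAt_const]
  exact (Υ.differentiableAt_comp hx j).neg

/-- The divergence of a tractor is invariantly defined. -/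
theorem tractorDiv_projectiveChange (hn : 2 ≤ n) {D D' : TorsionFreeConnection n M}
    {Υ : OneForm n M} (h : IsProjectiveChange D D' Υ) (v : ℝ) {e : Chart n M} {k : ℕ}
    {T : Coord n → (Fin (k + 1) → Fin n ⊕ Unit) → ℝ} {x : Coord n} (hx : x ∈ e.1.target)
    (hT : ∀ I, DifferentiableAt ℝ (fun y => T y I) x) (I : Fin k → Fin n ⊕ Unit) :
    tractorDiv D' v e (fun y => tensorAct (splittingChange (Υ.comp e y)) (T y)) x I
      = tensorAct (splittingChange (Υ.comp e x)) (tractorDiv D v e T x) I := by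
  have h1 : ∀ a K, covDeriv (tractorForm D' e) (densityForm D' v e)
        (fun y => tensorAct (splittingChange (Υ.comp e y)) (T y)) x a K
      = tensorAct (splittingChange (Υ.comp e x))
          (covDeriv (tractorForm D e) (densityForm D v e) T x a) K
        + (v + (k + 1)) * Υ.comp e x a * tensorAct (splittingChange (Υ.comp e x)) (T x) K := by
    intro a K
    -- Each of the `k + 1` indices contributes `Υₐ` and the density contributes `vΥₐ`. The sum `v +
    -- (k + 1)` is the weight of the tractor.
    rw [covDeriv_gauge (A := tractorForm D e) (θ := densityForm D v e)
      (g := fun y => splittingChange (Υ.comp e y)) (l := fun _ => 1) (S := T)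
      (μ := Υ.comp e x a) (ν := v * Υ.comp e x a) (differentiableAt_splittingChange Υ hx)
      (differentiableAt_const _) hT (Filter.Eventually.of_forall fun y I => by rw [one_mul])
      (tractorForm_projectiveChange hn h hx a)
      (by rw [pd_const, densityForm_projectiveChange h v hx]; ring) K]
    push_cast
    ring
  have h2 : tractorDiv D v e T x = fun J =>
      ∑ a, covDeriv (tractorForm D e) (densityForm D v e) T x a (Matrix.vecCons (Sum.inl a) J)
        + (v + (k + 1)) * T x (Matrix.vecCons (Sum.inr ()) J) := rfl
  -- The extra terms of the derivatives cancel against `-Υₐ T^{a…}` in the transformed bottom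
  -- component, which carries the same factor.
  rw [h2, tensorAct_add, tensorAct_sum, tensorAct_const_mul, tractorDiv]
  simp only [h1, tensorAct_splittingChange_inl, tensorAct_splittingChange_inr,
    Finset.sum_add_distrib, mul_sub, Finset.mul_sum, mul_assoc]
  ring

theorem isSymm_covDeriv {ι : Type} [Fintype ι] {k : ℕ} (A : Coord n → Fin n → Matrix ι ι ℝ)
    (θ : Coord n → Fin n → ℝ) {S : Coord n → (Fin k → ι) → ℝ} (hS : ∀ x, IsSymm (S x))
    (x : Coord n) (a : Fin n) : IsSymm (covDeriv A θ S x a) := by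
  intro I σ
  simp only [covDeriv]
  have h1 : (fun y => S y (I ∘ σ)) = fun y => S y I := funext fun y => hS y I σ
  rw [h1, hS x I σ, ← Equiv.sum_comp σ fun j => ∑ c, A x a (I j) c * S x (Function.update I j c)]
  congr 2
  refine Finset.sum_congr rfl fun j _ => Finset.sum_congr rfl fun c _ => ?_
  rw [← hS x (Function.update I (σ j) c) σ]
  congr 2
  ext j'
  simp [Function.update_apply]

theorem isSymm_tractorDiv (D : TorsionFreeConnection n M) (v : ℝ) (e : Chart n M) {k : ℕ}
    {T : Coord n → (Fin (k + 1) → Fin n ⊕ Unit) → ℝ} (hT : ∀ x, IsSymm (T x)) (x : Coord n) :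
    IsSymm (tractorDiv D v e T x) := by
  intro I σ
  refine congrArg₂ (· + ·) ?_ (congrArg (_ * ·) ((hT x).cons (Sum.inr ()) I σ))
  exact Finset.sum_congr rfl fun a _ => (isSymm_covDeriv _ _ hT x a).cons (Sum.inl a) I σ

theorem isSymm_covDiv (D : TorsionFreeConnection n M) (v : ℝ) (e : Chart n M) {k : ℕ}
    {S : Coord n → (Fin (k + 1) → Fin n) → ℝ} (hS : ∀ x, IsSymm (S x)) (x : Coord n) :
    IsSymm (covDiv D v e S x) := fun I σ =>
  Finset.sum_congr rfl fun a _ => (isSymm_covDeriv _ _ hS x a).cons a I σ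

theorem isSymm_schoutenContract (D : TorsionFreeConnection n M) (e : Chart n M) {k : ℕ}
    {S : Coord n → (Fin (k + 2) → Fin n) → ℝ} {x : Coord n} (hS : IsSymm (S x)) :
    IsSymm (schoutenContract D e S x) := fun I σ =>
  Finset.sum_congr rfl fun a _ => Finset.sum_congr rfl fun b _ =>
    congrArg (_ * ·) (((hS.cons a).cons b) I σ)

theorem slotIndex_update {k α : ℕ} (i : Fin α → Fin n) (j : Fin k) (hj : j.1 < α) (c : Fin n) :
    Function.update (slotIndex k i) j (Sum.inl c)
      = slotIndex k (Function.update i ⟨j.1, hj⟩ c) := by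
  ext j'
  by_cases h : j' = j
  · subst h; simp [slotIndex, hj]
  · have h' : j'.1 ≠ j.1 := fun h2 => h (Fin.ext h2)
    simp [slotIndex, h, h']

theorem sum_dite_lt {α k : ℕ} (h : α ≤ k) (H : Fin α → ℝ) (c : ℝ) :
    ∑ j : Fin k, (if hj : j.1 < α then H ⟨j.1, hj⟩ else c) = ∑ j, H j + (k - α) * c := by
  obtain ⟨m, rfl⟩ := Nat.exists_eq_add_of_le h
  rw [Fin.sum_univ_add]
  simp

/-- The slots of the divergence of a symmetric tractor. -/
theorem tractorDiv_slotIndex (D : TorsionFreeConnection n M) (v : ℝ) (e : Chart n M) {k : ℕ}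
    {T : Coord n → (Fin (k + 1) → Fin n ⊕ Unit) → ℝ} (hT : ∀ x, IsSymm (T x)) (x : Coord n)
    {β : ℕ} (hβ : β ≤ k) (i : Fin β → Fin n) :
    tractorDiv D v e T x (slotIndex k i)
      = covDiv D v e (fun y (i' : Fin (β + 1) → Fin n) => T y (slotIndex (k + 1) i')) x i
        + (v + n + (k + 1) + β) * T x (slotIndex (k + 1) i)
        - (k - β) * schoutenContract D e
            (fun y (i' : Fin (β + 2) → Fin n) => T y (slotIndex (k + 1) i')) x i := by
  have hinr : T x (Matrix.vecCons (Sum.inr ()) (slotIndex k i)) = T x (slotIndex (k + 1) i) :=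
    (hT x).congr_values (values_inr_cons_slotIndex hβ i)
  have h1 : ∀ a, covDeriv (tractorForm D e) (densityForm D v e) T x a
        (Matrix.vecCons (Sum.inl a) (slotIndex k i))
      = covDeriv (affineForm D e) (densityForm D v e)
          (fun y (i' : Fin (β + 1) → Fin n) => T y (slotIndex (k + 1) i')) x a (Matrix.vecCons a i)
        + (∑ j : Fin (β + 1), if a = (Matrix.vecCons a i : Fin (β + 1) → Fin n) j then 1 else 0)
          * T x (slotIndex (k + 1) i)
        - (k - β) * ∑ b, D.schouten e x a b
          * T x (slotIndex (k + 1) (Matrix.vecCons a (Matrix.vecCons b i))) := by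
    intro a
    have hcard : β + 1 ≤ k + 1 := by omega
    rw [← slotIndex_cons]
    set i' : Fin (β + 1) → Fin n := Matrix.vecCons a i with hi'
    obtain ⟨H, hH⟩ : ∃ H : Fin (β + 1) → ℝ, ∀ j', H j' = ∑ c, affineForm D e x a (i' j') c
          * T x (slotIndex (k + 1) (Function.update i' j' c))
        + (if a = i' j' then 1 else 0) * T x (slotIndex (k + 1) i) := ⟨_, fun _ => rfl⟩
    have hG : ∀ j : Fin (k + 1), ∑ c, tractorForm D e x a (slotIndex (k + 1) i' j) c
          * T x (Function.update (slotIndex (k + 1) i') j c)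
        = if hj : j.1 < β + 1 then
            H ⟨j.1, hj⟩
          else -∑ b, D.schouten e x a b
            * T x (slotIndex (k + 1) (Matrix.vecCons a (Matrix.vecCons b i))) := by
      intro j
      have hv := fun c => values_update (slotIndex (k + 1) i') j c
      rw [Fintype.sum_sum_type]
      by_cases hj : j.1 < β + 1
      · have hK : slotIndex (k + 1) i' j = Sum.inl (i' ⟨j.1, hj⟩) := by simp [slotIndex, hj]
        rw [dif_pos hj, hK, hH]
        simp only [slotIndex_update i' j hj, tractorForm, Matrix.fromBlocks_apply₁₁,
          Matrix.fromBlocks_apply₁₂, Matrix.of_apply, Finset.univ_unique, Finset.sum_singleton]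
        congr 1
        -- Replacing a tangential entry equal to `a` by the bottom entry removes `a` from the
        -- multiset, so what remains is the slot of `i`.
        split_ifs with ha
        · congr 1
          refine (hT x).congr_values ?_
          have h3 := hv (Sum.inr ())
          rw [hK, ← ha, hi', slotIndex_cons, values_cons, Multiset.cons_swap,
            ← slotIndex_cons, ← hi', Multiset.cons_inj_right] at h3
          rw [← values_inr_cons_slotIndex hβ, values_cons]
          exact h3
        · simp
      · have hK : slotIndex (k + 1) i' j = Sum.inr () := by simp [slotIndex, hj]
        rw [dif_neg hj, hK]
        simp only [tractorForm, Matrix.fromBlocks_apply₂₁, Matrix.fromBlocks_apply₂₂,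
          Matrix.of_apply, Matrix.zero_apply, zero_mul, Finset.sum_const_zero, add_zero, neg_mul,
          Finset.sum_neg_distrib]
        congr 1
        refine Finset.sum_congr rfl fun b _ => ?_
        congr 1
        refine (hT x).congr_values ?_
        have h3 := hv (Sum.inl b)
        have h4 := j.2
        rw [hK] at h3
        rw [← Multiset.cons_inj_right (Sum.inr ()), h3, values_slotIndex (by omega),
          values_slotIndex (by omega), hi', values_cons, values_cons, values_cons,
          show k + 1 - (β + 1) = (k + 1 - (β + 2)) + 1 by omega, Multiset.replicate_succ]
        simp only [Multiset.map_cons, Multiset.cons_add, Multiset.add_cons]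
        rw [Multiset.cons_swap (Sum.inr ()) (Sum.inl a), Multiset.cons_swap (Sum.inl b) (Sum.inl a),
          Multiset.cons_swap (Sum.inl b) (Sum.inr ()), Multiset.cons_swap (Sum.inl a) (Sum.inr ())]
    simp only [covDeriv]
    rw [Finset.sum_congr rfl fun j _ => hG j, sum_dite_lt hcard]
    simp only [hH, Finset.sum_add_distrib, ← Finset.sum_mul]
    push_cast
    ring
  simp only [tractorDiv, h1, hinr, Finset.sum_sub_distrib, Finset.sum_add_distrib,
    ← Finset.sum_mul, ← Finset.mul_sum]
  -- The contracted position gives the trace `n`, and each of the other `β` tangential positions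
  -- gives `1`. Together with the weight this is the coefficient of `V_β`.
  have h2 : (∑ a : Fin n, ∑ j : Fin (β + 1),
      if a = (Matrix.vecCons a i : Fin (β + 1) → Fin n) j then (1 : ℝ) else 0) = n + β := by
    rw [Finset.sum_comm, Fin.sum_univ_succ]
    simp
  rw [h2]
  simp only [covDiv, schoutenContract]
  ring

end TractorDivergence

/-! ## Projectively equivalent connections differ by a one-form -/

section Geodesics

variable {n : ℕ} {M : Type*} [TopologicalSpace M] [ChartedSpace (Coord n) M]

/-- A symmetric bilinear map `Q` such that `Q(v, v)` is proportional to `v` for all `v` is of the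
form `Q(v, w) = q(v) w + q(w) v`. -/
theorem exists_eq_of_proportional {Q : Fin n → Fin n → Fin n → ℝ}
    (hQ : ∀ c a b, Q c a b = Q c b a)
    (h : ∀ v : Fin n → ℝ, v ≠ 0 → ∃ r : ℝ, ∀ i, ∑ a, ∑ b, Q i a b * v a * v b = r * v i) :
    ∃ q : Fin n → ℝ, ∀ c a b,
      Q c a b = q a * (if c = b then 1 else 0) + q b * (if c = a then 1 else 0) := by
  have h1 : ∀ a c, c ≠ a → Q c a a = 0 := by
    intro a c hc
    obtain ⟨r, hr⟩ := h (Pi.single a 1) (by simp)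
    have := hr c
    simpa [Pi.single_apply, hc] using this
  have h2 : ∀ a b, a ≠ b → ∀ t : ℝ, ∃ r : ℝ, ∀ i,
      Q i a a + 2 * t * Q i a b + t ^ 2 * Q i b b
        = r * ((if i = a then 1 else 0) + t * (if i = b then 1 else 0)) := by
    intro a b hab t
    obtain ⟨r, hr⟩ := h (fun i => (if i = a then 1 else 0) + t * (if i = b then 1 else 0))
      (fun h0 => by have := congrFun h0 a; simp [hab] at this)
    refine ⟨r, fun i => ?_⟩
    rw [← hr i]
    simp only [mul_add, add_mul, mul_ite, ite_mul, mul_one, mul_zero, zero_mul,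
      Finset.sum_add_distrib, Finset.sum_ite_eq', Finset.mem_univ, if_true]
    rw [hQ i b a]
    ring
  -- For `Q` of the required form `Q^a_{aa} = 2 q_a`, so there is no other choice. The mixed entries
  -- are recovered from the vectors `e_a ± e_b`.
  refine ⟨fun a => Q a a a / 2, fun c a b => ?_⟩
  by_cases hab : a = b
  · subst hab
    by_cases hc : c = a
    · subst hc; simp
    · simp [hc, h1 a c hc]
  · obtain ⟨r, hr⟩ := h2 a b hab 1
    obtain ⟨s, hs⟩ := h2 a b hab (-1)
    have ra := hr a
    have rb := hr b
    have sa := hs a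
    have sb := hs b
    have rc := hr c
    have hba : b ≠ a := fun h => hab h.symm
    simp only [hab, hba, if_true, if_false, h1 a b hba, h1 b a hab] at ra rb sa sb
    by_cases hca : c = a
    · subst hca
      simp only [hab, if_true, if_false]
      linarith
    · by_cases hcb : c = b
      · subst hcb
        simp only [hca, if_true, if_false]
        linarith
      · simp only [hca, hcb, if_false, h1 a c hca, h1 b c hcb] at rc ⊢
        linarith

/-- Geodesics exist for all initial values. -/
theorem exists_geodesic (D : TorsionFreeConnection n M) (e : Chart n M) {x : Coord n}
    (hx : x ∈ e.1.target) {v : Coord n} (hv : v ≠ 0) :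
    ∃ s t : ℝ, s < 0 ∧ 0 < t ∧ ∃ c : ℝ → Coord n, D.IsUnparametrizedGeodesic e s t c ∧
      c 0 = x ∧ deriv c 0 = v := by
  -- The geodesic equation as a first order system for position and velocity.
  let F : Coord n × Coord n → Coord n × Coord n := fun q =>
    (q.2, WithLp.toLp 2 fun i => -∑ a, ∑ b, D.Γ e q.1 i a b * q.2 a * q.2 b)
  have hU : IsOpen (e.1.target ×ˢ (univ : Set (Coord n))) := e.1.open_target.prod isOpen_univ
  have happ : ∀ a : Fin n, ContDiff ℝ ∞ fun q : Coord n × Coord n => q.2 a := fun a =>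
    (EuclideanSpace.proj (𝕜 := ℝ) a : Coord n →L[ℝ] ℝ).contDiff.comp contDiff_snd
  have hF : ContDiffOn ℝ ∞ F (e.1.target ×ˢ univ) := by
    refine contDiff_snd.contDiffOn.prodMk (contDiffOn_euclidean.2 fun i => ?_)
    refine ContDiffOn.neg (ContDiffOn.sum fun a _ => ContDiffOn.sum fun b _ => ?_)
    exact (((D.smooth e i a b).comp contDiff_fst.contDiffOn fun q hq => hq.1).mul
      (happ a).contDiffOn).mul (happ b).contDiffOn
  have hF1 : ContDiffAt ℝ 1 F (x, v) :=
    (hF.contDiffAt (hU.mem_nhds ⟨hx, mem_univ _⟩)).of_le (WithTop.coe_le_coe.2 le_top)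
  obtain ⟨f, hf0, ε, hε, hf⟩ :=
    hF1.exists_forall_mem_closedBall_exists_eq_forall_mem_Ioo_hasDerivAt₀ 0
  simp only [zero_sub, zero_add] at hf
  have hcont : ContinuousAt f 0 := (hf 0 ⟨by linarith, hε⟩).continuousAt
  have hnhds : {q : Coord n × Coord n | q.1 ∈ e.1.target ∧ q.2 ≠ 0} ∈ nhds (f 0) := by
    rw [hf0]
    exact ((e.1.open_target.preimage continuous_fst).inter
      (isOpen_ne.preimage continuous_snd)).mem_nhds ⟨hx, hv⟩
  -- The time interval is shrunk so that the curve stays in the chart and its velocity stays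
  -- nonzero.
  obtain ⟨δ', hδ', hball⟩ := Metric.mem_nhds_iff.1 (hcont hnhds)
  set δ := min ε δ'
  have hδ : 0 < δ := lt_min hε hδ'
  have hJ : ∀ τ ∈ Ioo (-δ) δ, τ ∈ Ioo (-ε) ε ∧ (f τ).1 ∈ e.1.target ∧ (f τ).2 ≠ 0 := by
    intro τ hτ
    refine ⟨⟨by linarith [hτ.1, min_le_left ε δ'], by linarith [hτ.2, min_le_left ε δ']⟩, ?_⟩
    refine hball (a := τ) ?_
    rw [Metric.mem_ball, Real.dist_0_eq_abs, abs_lt]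
    exact ⟨by linarith [hτ.1, min_le_right ε δ'], by linarith [hτ.2, min_le_right ε δ']⟩
  have hc : ∀ τ ∈ Ioo (-δ) δ, HasDerivAt (fun t => (f t).1) (f τ).2 τ := fun τ hτ =>
    (ContinuousLinearMap.fst ℝ (Coord n) (Coord n)).hasFDerivAt.comp_hasDerivAt τ
      (hf τ (hJ τ hτ).1)
  have hu : ∀ τ ∈ Ioo (-δ) δ, HasDerivAt (fun t => (f t).2) (F (f τ)).2 τ := fun τ hτ =>
    (ContinuousLinearMap.snd ℝ (Coord n) (Coord n)).hasFDerivAt.comp_hasDerivAt τ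
      (hf τ (hJ τ hτ).1)
  have hfc : ContinuousOn f (Ioo (-δ) δ) := fun τ hτ =>
    (hf τ (hJ τ hτ).1).continuousAt.continuousWithinAt
  have hu1 : ContDiffOn ℝ 1 (fun t => (f t).2) (Ioo (-δ) δ) := by
    rw [show (1 : WithTop ℕ∞) = 0 + 1 from rfl, contDiffOn_succ_iff_deriv_of_isOpen isOpen_Ioo]
    refine ⟨fun τ hτ => (hu τ hτ).differentiableAt.differentiableWithinAt, by simp, ?_⟩
    rw [contDiffOn_zero]
    refine ContinuousOn.congr (f := fun τ => (F (f τ)).2) ?_ fun τ hτ => (hu τ hτ).deriv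
    exact continuous_snd.comp_continuousOn
      (hF.continuousOn.comp hfc fun τ hτ => ⟨(hJ τ hτ).2.1, mem_univ _⟩)
  have h0 : (0 : ℝ) ∈ Ioo (-δ) δ := ⟨by linarith, hδ⟩
  refine ⟨-δ, δ, by linarith, hδ, fun t => (f t).1, ⟨?_, fun τ hτ => (hJ τ hτ).2.1, ?_⟩, ?_, ?_⟩
  · rw [show (2 : WithTop ℕ∞) = 1 + 1 from rfl, contDiffOn_succ_iff_deriv_of_isOpen isOpen_Ioo]
    exact ⟨fun τ hτ => (hc τ hτ).differentiableAt.differentiableWithinAt, by simp,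
      hu1.congr fun τ hτ => (hc τ hτ).deriv⟩
  · intro τ hτ
    refine ⟨by rw [(hc τ hτ).deriv]; exact (hJ τ hτ).2.2, 0, fun i => ?_⟩
    have h1 : deriv (deriv fun t => (f t).1) τ = (F (f τ)).2 := by
      rw [← (hu τ hτ).deriv]
      exact Filter.EventuallyEq.deriv_eq
        (Filter.eventuallyEq_of_mem (isOpen_Ioo.mem_nhds hτ) fun t ht => (hc t ht).deriv)
    rw [h1, (hc τ hτ).deriv]
    simp [F]
  · simp [hf0]
  · rw [(hc 0 h0).deriv, hf0]

/-- The difference of two connections with the same unparametrized geodesics. -/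
theorem SameGeodesics.exists_sub_eq {D D' : TorsionFreeConnection n M} (h : SameGeodesics D D')
    (e : Chart n M) {x : Coord n} (hx : x ∈ e.1.target) :
    ∃ q : Fin n → ℝ, ∀ c a b, D'.Γ e x c a b - D.Γ e x c a b
      = q a * (if c = b then 1 else 0) + q b * (if c = a then 1 else 0) := by
  refine exists_eq_of_proportional (Q := fun c a b => D'.Γ e x c a b - D.Γ e x c a b)
    (fun c a b => by rw [D.torsionFree e x hx, D'.torsionFree e x hx]) fun v hv => ?_
  have hv' : (WithLp.toLp 2 v : Coord n) ≠ 0 := by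
    intro h0
    exact hv (funext fun i => congrFun (congrArg WithLp.ofLp h0) i)
  obtain ⟨s, t, hs, ht, c, hc, hc0, hcv⟩ := exists_geodesic D e hx hv'
  obtain ⟨-, r, hr⟩ := hc.2.2 0 ⟨hs, ht⟩
  obtain ⟨-, r', hr'⟩ := ((h e s t c).1 hc).2.2 0 ⟨hs, ht⟩
  -- One curve satisfies both geodesic equations with the same acceleration. Subtracting them at
  -- time zero leaves only the difference of the Christoffel symbols.
  refine ⟨r' - r, fun i => ?_⟩
  have h1 := hr i
  have h2 := hr' i
  rw [hc0, hcv] at h1 h2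
  simp only [sub_mul, Finset.sum_sub_distrib]
  simp only at h1 h2
  linarith

variable [IsManifold (𝓡 n) ∞ M]

/-- Weyl's theorem: connections with the same unparametrized geodesics differ by a one-form. -/
theorem SameGeodesics.exists_isProjectiveChange {D D' : TorsionFreeConnection n M}
    (h : SameGeodesics D D') : ∃ Υ : OneForm n M, IsProjectiveChange D D' Υ := by
  have hn : (n : ℝ) + 1 ≠ 0 := by positivity
  -- Taking the trace of `q_a δ^c_b + q_b δ^c_a` gives `(n + 1) q_a`. This formula makes the
  -- one-form smooth.
  let q : Chart n M → Coord n → Fin n → ℝ := fun e x a =>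
    (∑ c, (D'.Γ e x c a c - D.Γ e x c a c)) / (n + 1)
  have hq : ∀ e, ∀ x ∈ e.1.target, ∀ c a b, D'.Γ e x c a b - D.Γ e x c a b
      = q e x a * (if c = b then 1 else 0) + q e x b * (if c = a then 1 else 0) := by
    intro e x hx c a b
    obtain ⟨p, hp⟩ := h.exists_sub_eq e hx
    have h1 : ∀ a, q e x a = p a := by
      intro a
      simp only [q, hp]
      rw [div_eq_iff hn]
      simp [Finset.sum_add_distrib]
      ring
    rw [h1, h1, hp]
  refine ⟨⟨q, fun e a => ?_, fun e e' x hx a => ?_⟩, fun e x hx c a b => ?_⟩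
  · exact (ContDiffOn.sum fun c _ => (D'.smooth e c a c).sub (D.smooth e c a c)).div_const _
  · set K := jac e' e (transition e e' x)
    have hK : ∀ i j, ∑ a, K i a * jac e e' x a j = if i = j then 1 else 0 := fun i j => by
      rw [← Matrix.mul_apply, jac_mul_jac hx, Matrix.one_apply]
    -- The inhomogeneous terms of the two transformation laws cancel in the difference. The entries
    -- with both lower indices equal to `a` already suffice, once the common Jacobian factor is
    -- removed with `h6`.
    have h1 : ∀ c, jac e e' x c a * q e x a
        = jac e e' x c a * ∑ i, q e' (transition e e' x) i * jac e e' x i a := by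
      intro c
      have h2 := D.transform e e' x hx c a a
      have h3 := D'.transform e e' x hx c a a
      have h4 : ∑ d, jac e e' x c d * (D'.Γ e x d a a - D.Γ e x d a a)
          = ∑ i, ∑ j, (D'.Γ e' (transition e e' x) c i j - D.Γ e' (transition e e' x) c i j)
            * jac e e' x i a * jac e e' x j a := by
        simp only [mul_sub, sub_mul, Finset.sum_sub_distrib]
        rw [h2, h3]
        ring
      simp only [hq e x (mem_target_of_mem_overlap hx),
        hq e' _ (transition_mem_target hx)] at h4
      have h5 : ∀ i, ∑ j, (q e' (transition e e' x) i * (if c = j then 1 else 0)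
            + q e' (transition e e' x) j * (if c = i then 1 else 0))
            * jac e e' x i a * jac e e' x j a
          = q e' (transition e e' x) i * jac e e' x i a * jac e e' x c a
            + (if c = i then 1 else 0) * (jac e e' x i a *
              ∑ j, q e' (transition e e' x) j * jac e e' x j a) := by
        intro i
        simp only [add_mul, Finset.sum_add_distrib, Finset.mul_sum]
        congr 1
        · simp
        · exact Finset.sum_congr rfl fun j _ => by ring
      simp only [h5, Finset.sum_add_distrib, ← Finset.sum_mul] at h4
      simp only [mul_add, mul_ite, ite_mul, mul_one, mul_zero, one_mul, zero_mul,
        Finset.sum_add_distrib, Finset.sum_ite_eq, Finset.sum_ite_eq', Finset.mem_univ,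
        if_true] at h4
      linarith
    have h6 : ∀ r : ℝ, r = ∑ c, K a c * (jac e e' x c a * r) := by
      intro r
      simp only [← mul_assoc, ← Finset.sum_mul, hK, if_true, one_mul]
    rw [h6 (q e x a), h6 (∑ i, q e' (transition e e' x) i * jac e e' x i a)]
    simp only [h1]
  · have := hq e x hx c a b
    simp only
    linarith

end Geodesics

/-! ## The recursion for the slots of a lift -/

section Tower

variable {n : ℕ} {M : Type*} [TopologicalSpace M] [ChartedSpace (Coord n) M]

theorem covDiv_congr (D : TorsionFreeConnection n M) (u : ℝ) (e : Chart n M) {k : ℕ}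
    {S S' : Coord n → (Fin (k + 1) → Fin n) → ℝ} {O : Set (Coord n)} (hO : IsOpen O)
    (h : ∀ y ∈ O, S y = S' y) {x : Coord n} (hx : x ∈ O) :
    covDiv D u e S x = covDiv D u e S' x := by
  ext i
  refine Finset.sum_congr rfl fun a _ => ?_
  simp only [covDeriv, h x hx]
  rw [pd_congr_of_isOpen hO hx (fun y hy => by rw [h y hy])]

theorem covDiv_sum (D : TorsionFreeConnection n M) (u : ℝ) (e : Chart n M) {k : ℕ} {κ : Type*}
    (s : Finset κ) (r : κ → ℝ) {S : κ → Coord n → (Fin (k + 1) → Fin n) → ℝ} {x : Coord n}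
    (h : ∀ q I, DifferentiableAt ℝ (fun y => S q y I) x) (i : Fin k → Fin n) :
    covDiv D u e (fun y I => ∑ q ∈ s, r q * S q y I) x i
      = ∑ q ∈ s, r q * covDiv D u e (S q) x i := by
  simp only [covDiv, covDeriv, Finset.mul_sum]
  rw [Finset.sum_comm]
  refine Finset.sum_congr rfl fun a _ => ?_
  rw [pd_sum (F := fun q y => r q * S q y (Matrix.vecCons a i)) fun q _ => (h q _).const_mul (r q)]
  simp only [pd_const_mul (h _ _), mul_add, Finset.sum_add_distrib, Finset.mul_sum]
  congr 1
  · congr 1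
    conv_rhs => rw [Finset.sum_comm]
    refine Finset.sum_congr rfl fun j _ => ?_
    conv_rhs => rw [Finset.sum_comm]
    exact Finset.sum_congr rfl fun c _ => Finset.sum_congr rfl fun q _ => by ring
  · exact Finset.sum_congr rfl fun q _ => by ring

theorem covDiv_const_mul (D : TorsionFreeConnection n M) (u : ℝ) (e : Chart n M) {k : ℕ} (r : ℝ)
    {S : Coord n → (Fin (k + 1) → Fin n) → ℝ} {x : Coord n}
    (h : ∀ I, DifferentiableAt ℝ (fun y => S y I) x) (i : Fin k → Fin n) :
    covDiv D u e (fun y I => r * S y I) x i = r * covDiv D u e S x i := by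
  simpa using covDiv_sum D u e {()} (fun _ => r) (S := fun _ => S) (fun _ => h) i

theorem schoutenContract_sum (D : TorsionFreeConnection n M) (e : Chart n M) {k : ℕ} {κ : Type*}
    (s : Finset κ) (r : κ → ℝ) (S : κ → Coord n → (Fin (k + 2) → Fin n) → ℝ) (x : Coord n)
    (i : Fin k → Fin n) :
    schoutenContract D e (fun y I => ∑ q ∈ s, r q * S q y I) x i
      = ∑ q ∈ s, r q * schoutenContract D e (S q) x i := by
  simp only [schoutenContract, Finset.mul_sum]
  conv_rhs => rw [Finset.sum_comm]
  refine Finset.sum_congr rfl fun a _ => ?_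
  conv_rhs => rw [Finset.sum_comm]
  exact Finset.sum_congr rfl fun b _ => Finset.sum_congr rfl fun q _ => by ring

theorem contDiffOn_curvature (D : TorsionFreeConnection n M) (e : Chart n M) (a b c d : Fin n) :
    ContDiffOn ℝ ∞ (fun x => D.curvature e x a b c d) e.1.target := by
  have hpd := fun c a b f => contDiffOn_pd e.1.open_target (D.smooth e c a b) f
  exact (((hpd c b d a).sub (hpd c a d b)).add (ContDiffOn.sum fun f _ =>
    (D.smooth e c a f).mul (D.smooth e f b d))).sub (ContDiffOn.sum fun f _ =>
    (D.smooth e c b f).mul (D.smooth e f a d))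

theorem contDiffOn_schouten (D : TorsionFreeConnection n M) (e : Chart n M) (a b : Fin n) :
    ContDiffOn ℝ ∞ (fun x => D.schouten e x a b) e.1.target := by
  have hr : ∀ b d, ContDiffOn ℝ ∞ (fun x => D.ricci e x b d) e.1.target := fun b d =>
    ContDiffOn.sum fun a _ => contDiffOn_curvature D e a b a d
  exact ((contDiffOn_const.mul (hr a b)).add (hr b a)).div_const _

theorem contDiffOn_covDiv (D : TorsionFreeConnection n M) (u : ℝ) (e : Chart n M) {k : ℕ}
    {S : Coord n → (Fin (k + 1) → Fin n) → ℝ}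
    (h : ∀ I, ContDiffOn ℝ ∞ (fun y => S y I) e.1.target) (i : Fin k → Fin n) :
    ContDiffOn ℝ ∞ (fun x => covDiv D u e S x i) e.1.target := by
  refine ContDiffOn.sum fun a _ => ((contDiffOn_pd e.1.open_target (h _) a).add
    (ContDiffOn.sum fun j _ => ContDiffOn.sum fun c _ => ?_)).add (ContDiffOn.mul ?_ (h _))
  · exact (D.smooth e _ a c).mul (h _)
  · exact contDiffOn_const.mul (ContDiffOn.sum fun c _ => D.smooth e c a c)

theorem contDiffOn_schoutenContract (D : TorsionFreeConnection n M) (e : Chart n M) {k : ℕ}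
    {S : Coord n → (Fin (k + 2) → Fin n) → ℝ}
    (h : ∀ I, ContDiffOn ℝ ∞ (fun y => S y I) e.1.target) (i : Fin k → Fin n) :
    ContDiffOn ℝ ∞ (fun x => schoutenContract D e S x i) e.1.target :=
  ContDiffOn.sum fun a _ => ContDiffOn.sum fun b _ => (contDiffOn_schouten D e a b).mul (h _)

/-- The tensors `U_γ` of valence `γ ≤ k` with `U_k = V` and
`U_γ = ∇·U_{γ+1} + (k - γ - 1) (v + n + k + γ + 1) P·U_{γ+2}`. -/
def tower (D : TorsionFreeConnection n M) (v : ℝ) (e : Chart n M) {k : ℕ}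
    (V : Coord n → (Fin k → Fin n) → ℝ) (γ : ℕ) : Coord n → (Fin γ → Fin n) → ℝ :=
  if γ < k then fun x i => covDiv D v e (tower D v e V (γ + 1)) x i
    + (k - (γ + 1)) * (v + n + k + (γ + 1)) * schoutenContract D e (tower D v e V (γ + 2)) x i
  else if h : γ = k then fun x i => V x (i ∘ Fin.cast h.symm) else 0
termination_by k - γ

variable (D : TorsionFreeConnection n M) (v : ℝ) (e : Chart n M) {k : ℕ}
  {V : Coord n → (Fin k → Fin n) → ℝ}

theorem tower_self : tower D v e V k = V := by
  rw [tower]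
  simp

theorem tower_of_lt {γ : ℕ} (h : γ < k) : tower D v e V γ = fun x i =>
    covDiv D v e (tower D v e V (γ + 1)) x i
    + (k - (γ + 1)) * (v + n + k + (γ + 1)) * schoutenContract D e (tower D v e V (γ + 2)) x i := by
  rw [tower]
  simp [h]

theorem tower_of_gt {γ : ℕ} (h : k < γ) : tower D v e V γ = 0 := by
  rw [tower]
  simp [h.not_gt, h.ne']

/-- Descending two-step induction. Valences above `k` are included because the step at `k - 1`
refers to `k + 1`. -/
theorem tower_induction {k : ℕ} {P : ℕ → Prop} (gt : ∀ γ, k < γ → P γ) (self : P k)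
    (lt : ∀ γ < k, P (γ + 1) → P (γ + 2) → P γ) (γ : ℕ) : P γ := by
  induction hm : k - γ using Nat.strong_induction_on generalizing γ with
  | _ m ih =>
    rcases lt_trichotomy γ k with h | h | h
    · exact lt γ h (ih _ (by omega) _ rfl) (by
        by_cases h2 : γ + 2 ≤ k
        · exact ih _ (by omega) _ rfl
        · exact gt _ (by omega))
    · exact h ▸ self
    · exact gt γ h

theorem isSymm_tower (hV : ∀ x, IsSymm (V x)) (γ : ℕ) : ∀ x, IsSymm (tower D v e V γ x) := by
  induction γ using tower_induction (k := k) with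
  | gt γ h => rw [tower_of_gt D v e h]; exact fun x I σ => rfl
  | self => rwa [tower_self]
  | lt γ h h1 h2 =>
    rw [tower_of_lt D v e h]
    intro x I σ
    simp only [isSymm_covDiv D v e h1 x I σ, isSymm_schoutenContract D e (h2 x) I σ]

theorem contDiffOn_tower (hV : ∀ I, ContDiffOn ℝ ∞ (fun y => V y I) e.1.target) (γ : ℕ) :
    ∀ I, ContDiffOn ℝ ∞ (fun y => tower D v e V γ y I) e.1.target := by
  induction γ using tower_induction (k := k) with
  | gt γ h => rw [tower_of_gt D v e h]; exact fun I => contDiffOn_const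
  | self => rwa [tower_self]
  | lt γ h h1 h2 =>
    rw [tower_of_lt D v e h]
    exact fun I => (contDiffOn_covDiv D v e h1 I).add
      (contDiffOn_const.mul (contDiffOn_schoutenContract D e h2 I))

theorem differentiableAt_tower (hV : ∀ I, ContDiffOn ℝ ∞ (fun y => V y I) e.1.target) (γ : ℕ)
    {x : Coord n} (hx : x ∈ e.1.target) (I : Fin γ → Fin n) :
    DifferentiableAt ℝ (fun y => tower D v e V γ y I) x :=
  differentiableAt_of_contDiffOn e.1.open_target (contDiffOn_tower D v e hV γ I) hx

theorem tower_chart [IsManifold (𝓡 n) ∞ M] {e e' : Chart n M} {V V' : Coord n → (Fin k → Fin n) → ℝ}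
    (hV : ∀ I, ContDiffOn ℝ ∞ (fun y => V y I) e.1.target)
    (hV' : ∀ I, ContDiffOn ℝ ∞ (fun y => V' y I) e'.1.target)
    (h : ∀ x ∈ overlap e e', ∀ I, V' (transition e e' x) I
      = densityFactor v e e' x * tensorAct (jac e e' x) (V x) I) (γ : ℕ) :
    ∀ x ∈ overlap e e', ∀ I, tower D v e' V' γ (transition e e' x) I
      = densityFactor v e e' x * tensorAct (jac e e' x) (tower D v e V γ x) I := by
  induction γ using tower_induction (k := k) with
  | gt γ h =>
    rw [tower_of_gt D v e h, tower_of_gt D v e' h]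
    intro x _ I
    simp [tensorAct]
  | self => rwa [tower_self, tower_self]
  | lt γ hγ h1 h2 =>
    intro x hx I
    rw [tower_of_lt D v e hγ, tower_of_lt D v e' hγ, tensorAct_add, tensorAct_const_mul]
    simp only
    rw [covDiv_chart D v hx (differentiableAt_tower D v e hV _ (mem_target_of_mem_overlap hx))
      (differentiableAt_tower D v e' hV' _ (transition_mem_target hx)) h1,
      schoutenContract_chart D hx (h2 x hx)]
    ring

/-- The factor between the slot of valence `γ` of a lift and `tower`. -/
def slotFactor (n k : ℕ) (v : ℝ) (γ : ℕ) : ℝ := ∏ δ ∈ Finset.Ico γ k, -(v + n + k + δ)⁻¹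

theorem slotFactor_self (n k : ℕ) (v : ℝ) : slotFactor n k v k = 1 := by simp [slotFactor]

theorem slotFactor_succ {n k : ℕ} {v : ℝ} {γ : ℕ} (h : γ < k) (hc : v + n + k + γ ≠ 0) :
    slotFactor n k v (γ + 1) = -(v + n + k + γ) * slotFactor n k v γ := by
  rw [slotFactor, slotFactor, Finset.prod_eq_prod_Ico_succ_bot h]
  field_simp

theorem slotFactor_ne_zero {n k : ℕ} {v : ℝ} {γ : ℕ}
    (hc : ∀ δ, γ ≤ δ → δ < k → v + n + k + δ ≠ 0) : slotFactor n k v γ ≠ 0 :=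
  Finset.prod_ne_zero_iff.2 fun δ hδ => by
    rw [Finset.mem_Ico] at hδ
    exact neg_ne_zero.2 (inv_ne_zero (hc δ hδ.1 hδ.2))

/-- The coefficient `v + n + k + β` does not have to be nonzero here, so this computation remains
available at the excluded weight. -/
theorem covDiv_sub_schoutenContract_tower
    (hV : ∀ I, ContDiffOn ℝ ∞ (fun y => V y I) e.1.target) {β : ℕ} (hβ : β < k)
    (hc' : β + 1 < k → v + n + k + (β + 1 : ℕ) ≠ 0) {x : Coord n} (hx : x ∈ e.1.target)
    (i : Fin β → Fin n) :
    covDiv D v e (fun y I => slotFactor n k v (β + 1) * tower D v e V (β + 1) y I) x i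
      - (k - (β + 1)) * schoutenContract D e
          (fun y I => slotFactor n k v (β + 2) * tower D v e V (β + 2) y I) x i
      = slotFactor n k v (β + 1) * tower D v e V β x i := by
  have h1 := schoutenContract_sum D e {()} (fun _ => slotFactor n k v (β + 2))
    (fun _ => tower D v e V (β + 2)) x i
  simp only [Finset.sum_singleton] at h1
  rw [covDiv_const_mul D v e _ (differentiableAt_tower D v e hV _ hx), h1, tower_of_lt D v e hβ]
  by_cases h2 : β + 1 < k
  · have h3 := slotFactor_succ h2 (hc' h2)
    change slotFactor n k v (β + 2) = _ at h3
    rw [h3]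
    push_cast
    ring
  -- In the last valence below `k` the factor `k - (β + 1)` kills the terms of valence `k + 1`,
  -- which have no meaning.
  · have h3 : (k : ℝ) = β + 1 := by
      have : k = β + 1 := by omega
      exact_mod_cast this
    rw [h3]
    ring

/-- The multiples of `tower` by `slotFactor` solve the equations for the slots of a lift. -/
theorem covDiv_slotFactor_mul_tower (hV : ∀ I, ContDiffOn ℝ ∞ (fun y => V y I) e.1.target)
    {β : ℕ} (hβ : β < k) (hc : v + n + k + β ≠ 0)
    (hc' : β + 1 < k → v + n + k + (β + 1 : ℕ) ≠ 0) {x : Coord n} (hx : x ∈ e.1.target)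
    (i : Fin β → Fin n) :
    covDiv D v e (fun y I => slotFactor n k v (β + 1) * tower D v e V (β + 1) y I) x i
      + (v + n + k + β) * (slotFactor n k v β * tower D v e V β x i)
      - (k - (β + 1)) * schoutenContract D e
          (fun y I => slotFactor n k v (β + 2) * tower D v e V (β + 2) y I) x i = 0 := by
  have h1 := covDiv_sub_schoutenContract_tower D v e hV hβ hc' hx i
  have h2 := slotFactor_succ hβ hc
  rw [h2] at h1 ⊢
  linear_combination h1

/-- The equations for the slots of a lift determine them. -/
theorem eq_slotFactor_mul_tower (hV : ∀ I, ContDiffOn ℝ ∞ (fun y => V y I) e.1.target)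
    {α : ℕ} (hc : ∀ δ, α ≤ δ → δ < k → v + n + k + δ ≠ 0)
    {W : ∀ γ : ℕ, Coord n → (Fin γ → Fin n) → ℝ} (hW : ∀ x ∈ e.1.target, W k x = V x)
    (h : ∀ β, α ≤ β → β < k → ∀ x ∈ e.1.target, ∀ i, covDiv D v e (W (β + 1)) x i
      + (v + n + k + β) * W β x i - (k - (β + 1)) * schoutenContract D e (W (β + 2)) x i = 0)
    (γ : ℕ) : α ≤ γ → γ ≤ k → ∀ x ∈ e.1.target, ∀ I,
      W γ x I = slotFactor n k v γ * tower D v e V γ x I := by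
  induction γ using tower_induction (k := k) with
  | gt γ h => intro _ h2; omega
  | self =>
    intro _ _ x hx I
    rw [slotFactor_self, tower_self, hW x hx, one_mul]
  | lt β hβ h1 h2 =>
    intro hα _ x hx i
    have h3 := h β hα hβ x hx i
    have hc1 := hc β hα hβ
    have h4 := covDiv_slotFactor_mul_tower D v e hV hβ hc1 (fun h => hc _ (by omega) h) hx i
    rw [covDiv_congr D v e e.1.open_target (fun y hy => funext (h1 (by omega) hβ y hy)) hx] at h3
    have h5 : ((k : ℝ) - (β + 1)) * schoutenContract D e (W (β + 2)) x i
        = (k - (β + 1)) * schoutenContract D e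
          (fun y I => slotFactor n k v (β + 2) * tower D v e V (β + 2) y I) x i := by
      by_cases h6 : β + 2 ≤ k
      · simp only [schoutenContract, h2 (by omega) h6 x hx]
      · have h7 : (k : ℝ) = β + 1 := by
          have : k = β + 1 := by omega
          exact_mod_cast this
        rw [h7]; ring
    rw [h5] at h3
    exact mul_left_cancel₀ hc1 (by linarith)

end Tower

/-! ## Words of differential operators -/

namespace DiffWord

section Words

variable {n : ℕ} {M : Type*} [TopologicalSpace M] [ChartedSpace (Coord n) M]

/-- The word consisting of divergences only. -/
def divWord (k γ : ℕ) (h : γ ≤ k) : DiffWord k γ :=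
  if h' : γ = k then h' ▸ nil else div (divWord k (γ + 1) (by omega))
termination_by k - γ

theorem divWord_self (k : ℕ) : divWord k k le_rfl = nil := by
  rw [divWord]
  simp

theorem divWord_of_lt {k γ : ℕ} (h : γ < k) : divWord k γ h.le = div (divWord k (γ + 1) h) := by
  rw [divWord]
  simp [h.ne]

/-- `iterDiv` peels off the innermost divergence, `divWord` the outermost one. A family indexed by
valence reconciles the two recursions without casts. -/
theorem iterDiv_eq_of_forall (D : TorsionFreeConnection n M) (u : ℝ) (e : Chart n M) {β : ℕ}
    (F : ∀ γ : ℕ, Coord n → (Fin γ → Fin n) → ℝ) :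
    ∀ m, (∀ γ < β + m, F γ = covDiv D u e (F (γ + 1))) → iterDiv D u e m (F (β + m)) = F β
  | 0, _ => rfl
  | m + 1, h => by
    have h1 := iterDiv_eq_of_forall D u e (β := β) F m fun γ hγ => h γ (by omega)
    rw [h (β + m) (by omega)] at h1
    exact h1

theorem eval_divWord (D : TorsionFreeConnection n M) (u : ℝ) (e : Chart n M) (β m : ℕ)
    (S : Coord n → (Fin (β + m) → Fin n) → ℝ) :
    (divWord (β + m) β (by omega)).eval D u e S = iterDiv D u e m S := by
  have h := iterDiv_eq_of_forall D u e (β := β)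
    (fun γ => if h : γ ≤ β + m then (divWord (β + m) γ h).eval D u e S else 0) m (by
      intro γ hγ
      rw [dif_pos hγ.le, dif_pos (Nat.succ_le_of_lt hγ), divWord_of_lt hγ]
      rfl)
  rw [dif_pos le_rfl, dif_pos (by omega), divWord_self] at h
  exact h.symm

theorem contDiffOn_eval (D : TorsionFreeConnection n M) (u : ℝ) (e : Chart n M) {k : ℕ}
    {S : Coord n → (Fin k → Fin n) → ℝ}
    (hS : ∀ I, ContDiffOn ℝ ∞ (fun y => S y I) e.1.target) :
    ∀ {β : ℕ} (w : DiffWord k β) (I), ContDiffOn ℝ ∞ (fun y => w.eval D u e S y I) e.1.target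
  | _, nil => hS
  | _, div w => contDiffOn_covDiv D u e (contDiffOn_eval D u e hS w)
  | _, schouten w => contDiffOn_schoutenContract D e (contDiffOn_eval D u e hS w)

/-- The linear combinations of words which compute `tower`. -/
theorem exists_tower_eq (n k : ℕ) (v : ℝ) (γ : ℕ) : ∀ hγ : γ ≤ k,
    ∃ c : DiffWord k γ →₀ ℝ, (∀ w ∈ c.support, 1 ≤ w.curvatureDegree) ∧
      ∀ (M : Type*) [TopologicalSpace M] [ChartedSpace (Coord n) M]
        (D : TorsionFreeConnection n M) (e : Chart n M) (V : Coord n → (Fin k → Fin n) → ℝ),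
        (∀ I, ContDiffOn ℝ ∞ (fun y => V y I) e.1.target) → ∀ x ∈ e.1.target, ∀ i,
          tower D v e V γ x i
            = (Finsupp.single (divWord k γ hγ) 1 + c).sum fun w r => r * w.eval D v e V x i := by
  induction γ using tower_induction (k := k) with
  | gt γ h => intro h'; omega
  | self =>
    intro _
    refine ⟨0, by simp, fun M _ _ D e V _ x _ i => ?_⟩
    rw [tower_self, divWord_self, add_zero, Finsupp.sum_single_index (by simp), one_mul]
    rfl
  | lt γ hγ h1 h2 =>
    intro _
    obtain ⟨c₁, hc₁, H₁⟩ := h1 hγ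
    set r : ℝ := (k - (γ + 1)) * (v + n + k + (γ + 1)) with hr
    -- The contribution of valence `γ + 2` is stated with its factor `r`, so that it also holds for
    -- `γ + 1 = k`, where `r = 0` and no word exists.
    obtain ⟨C₂, H₂⟩ : ∃ C₂ : DiffWord k (γ + 2) →₀ ℝ,
        ∀ (M : Type _) [TopologicalSpace M] [ChartedSpace (Coord n) M]
          (D : TorsionFreeConnection n M) (e : Chart n M) (V : Coord n → (Fin k → Fin n) → ℝ),
          (∀ I, ContDiffOn ℝ ∞ (fun y => V y I) e.1.target) → ∀ x ∈ e.1.target, ∀ i,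
            r * tower D v e V (γ + 2) x i = r * C₂.sum fun w r => r * w.eval D v e V x i := by
      by_cases h3 : γ + 2 ≤ k
      · obtain ⟨c₂, -, H₂⟩ := h2 h3
        exact ⟨_, fun M _ _ D e V hV x hx i => by rw [H₂ M D e V hV x hx i]⟩
      · refine ⟨0, fun M _ _ D e V hV x hx i => ?_⟩
        have h4 : r = 0 := by
          have : k = γ + 1 := by omega
          have : (k : ℝ) = γ + 1 := by exact_mod_cast this
          rw [hr, this]; ring
        rw [h4]; ring
    classical
    -- A further divergence preserves the curvature degree and a contraction with `P` raises it.
    -- Only the leading word of valence `γ + 1` yields a word without curvature.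
    refine ⟨c₁.mapDomain div + r • C₂.mapDomain schouten, fun w hw => ?_,
      fun M _ _ D e V hV x hx i => ?_⟩
    · rcases Finset.mem_union.1 (Finsupp.support_add hw) with h3 | h3
      · obtain ⟨w', hw', rfl⟩ := Finset.mem_image.1 (Finsupp.mapDomain_support h3)
        exact hc₁ w' hw'
      · obtain ⟨w', hw', rfl⟩ :=
          Finset.mem_image.1 (Finsupp.mapDomain_support (Finsupp.support_smul h3))
        exact Nat.le_add_left 1 _
    · set C₁ := Finsupp.single (divWord k (γ + 1) hγ) 1 + c₁
      have h3 : Finsupp.single (divWord k γ hγ.le) (1 : ℝ)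
          + (c₁.mapDomain div + r • C₂.mapDomain schouten)
          = C₁.mapDomain div + r • C₂.mapDomain schouten := by
        rw [Finsupp.mapDomain_add, Finsupp.mapDomain_single, ← divWord_of_lt hγ, add_assoc]
      have h4 : covDiv D v e (tower D v e V (γ + 1)) x i
          = (C₁.mapDomain div).sum fun w r => r * w.eval D v e V x i := by
        rw [Finsupp.sum_mapDomain_index (by simp) (by intros; ring),
          covDiv_congr D v e e.1.open_target (fun y hy => funext (H₁ M D e V hV y hy)) hx]
        exact covDiv_sum D v e _ _ (fun w I => differentiableAt_of_contDiffOn e.1.open_target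
          (contDiffOn_eval D v e hV w I) hx) i
      have h5 : r * schoutenContract D e (tower D v e V (γ + 2)) x i
          = (r • C₂.mapDomain schouten).sum fun w r => r * w.eval D v e V x i := by
        rw [Finsupp.sum_smul_index (by simp)]
        simp only [mul_assoc]
        rw [← Finsupp.mul_sum, Finsupp.sum_mapDomain_index (by simp) (by intros; ring)]
        have h6 := schoutenContract_sum D e C₂.support C₂ (fun w => w.eval D v e V) x i
        refine Eq.trans ?_ (congrArg (r * ·) h6)
        simp only [schoutenContract, Finset.mul_sum]
        refine Finset.sum_congr rfl fun a _ => Finset.sum_congr rfl fun b _ => ?_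
        rw [mul_left_comm, H₂ M D e V hV x hx, Finsupp.sum, Finset.mul_sum, Finset.mul_sum]
        exact Finset.sum_congr rfl fun w _ => by ring
      rw [tower_of_lt D v e hγ, h3, Finsupp.sum_add_index' (by simp) (by intros; ring), ← h4, ← h5]

end Words

end DiffWord

/-! ## Local lifts -/

section LocalLifts

variable {n : ℕ}

/-- The number of tangential indices. -/
def leftCount {k : ℕ} (I : Fin k → Fin n ⊕ Unit) : ℕ := (values I).countP fun A => A.isLeft = true

theorem leftCount_cons_inl {k : ℕ} (a : Fin n) (I : Fin k → Fin n ⊕ Unit) :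
    leftCount (Matrix.vecCons (Sum.inl a) I) = leftCount I + 1 := by
  rw [leftCount, values_cons, Multiset.countP_cons_of_pos _ (by simp), leftCount]

theorem leftCount_cons_inr {k : ℕ} (I : Fin k → Fin n ⊕ Unit) :
    leftCount (Matrix.vecCons (Sum.inr ()) I) = leftCount I := by
  simp [leftCount, values_cons]

theorem leftCount_le {k : ℕ} (I : Fin k → Fin n ⊕ Unit) : leftCount I ≤ k :=
  (Multiset.countP_le_card _ _).trans_eq (card_values I)

theorem leftCount_slotIndex : ∀ {k α : ℕ} (_ : α ≤ k) (i : Fin α → Fin n),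
    leftCount (slotIndex k i) = α
  | 0, 0, _, i => by simp [leftCount]
  | k + 1, 0, _, i => by
    rw [slotIndex_succ_zero, leftCount_cons_inr, leftCount_slotIndex (Nat.zero_le k)]
  | k + 1, α + 1, h, i => by
    have h1 : i = Matrix.vecCons (i 0) (Fin.tail i) := (Fin.cons_self_tail i).symm
    rw [h1, slotIndex_cons, leftCount_cons_inl, leftCount_slotIndex (Nat.le_of_succ_le_succ h)]

theorem tensorAct_eq_zero {ι : Type} [Fintype ι] {k : ℕ} (g : Matrix ι ι ℝ)
    {T : (Fin k → ι) → ℝ} (hT : ∀ J, T J = 0) (I : Fin k → ι) : tensorAct g T I = 0 :=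
  Finset.sum_eq_zero fun J _ => by rw [hT, mul_zero]

theorem tensorAct_zero_index {ι : Type} [Fintype ι] (g : Matrix ι ι ℝ) (T : (Fin 0 → ι) → ℝ)
    (I : Fin 0 → ι) : tensorAct g T I = T I := by
  simp [tensorAct, Subsingleton.elim (default : Fin 0 → ι) I]

/-- The first nonvanishing slot does not depend on the splitting. -/
theorem tensorAct_splittingChange_slotIndex (Υ : Fin n → ℝ) :
    ∀ {k α : ℕ} (_ : α ≤ k) {T : (Fin k → Fin n ⊕ Unit) → ℝ} (_ : ∀ I, α < leftCount I → T I = 0)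
      (i : Fin α → Fin n),
      tensorAct (splittingChange Υ) T (slotIndex k i) = T (slotIndex k i)
  | 0, 0, _, T, _, i => tensorAct_zero_index _ _ _
  | k + 1, 0, _, T, hT, i => by
    rw [slotIndex_succ_zero, tensorAct_splittingChange_inr,
      tensorAct_splittingChange_slotIndex Υ (Nat.zero_le k)
        fun I hI => hT _ (by rwa [leftCount_cons_inr])]
    have h1 : ∀ a, tensorAct (splittingChange Υ) (fun J => T (Matrix.vecCons (Sum.inl a) J))
        (slotIndex k i) = 0 := fun a =>
      tensorAct_eq_zero _ (fun J => hT _ (by rw [leftCount_cons_inl]; omega)) _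
    simp [h1]
  | k + 1, α + 1, h, T, hT, i => by
    have h1 : i = Matrix.vecCons (i 0) (Fin.tail i) := (Fin.cons_self_tail i).symm
    rw [h1, slotIndex_cons, tensorAct_splittingChange_inl,
      tensorAct_splittingChange_slotIndex Υ (Nat.le_of_succ_le_succ h)
        fun I hI => hT _ (by rw [leftCount_cons_inl]; omega)]

/-- A block diagonal matrix does not mix the slots, so tractors can be built chart by chart out of
naturally transforming slots. -/
theorem tensorAct_fromBlocks_slotIndex (J : Matrix (Fin n) (Fin n) ℝ) :
    ∀ {k α : ℕ} (_ : α ≤ k) (T : (Fin k → Fin n ⊕ Unit) → ℝ) (i : Fin α → Fin n),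
      tensorAct (Matrix.fromBlocks J 0 0 1) T (slotIndex k i)
        = tensorAct J (fun i' => T (slotIndex k i')) i
  | 0, 0, _, T, i => by
    rw [tensorAct_zero_index, tensorAct_zero_index]
  | k + 1, 0, _, T, i => by
    rw [slotIndex_succ_zero, tensorAct_cons, Fintype.sum_sum_type, tensorAct_zero_index,
      slotIndex_succ_zero]
    simp [tensorAct_fromBlocks_slotIndex J (Nat.zero_le k), tensorAct_zero_index]
  | k + 1, α + 1, h, T, i => by
    have h1 : i = Matrix.vecCons (i 0) (Fin.tail i) := (Fin.cons_self_tail i).symm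
    rw [h1, slotIndex_cons, tensorAct_cons, tensorAct_cons, Fintype.sum_sum_type]
    simp [tensorAct_fromBlocks_slotIndex J (Nat.le_of_succ_le_succ h), slotIndex_cons]

variable {M : Type*} [TopologicalSpace M] [ChartedSpace (Coord n) M]

theorem tractorDiv_congr (D : TorsionFreeConnection n M) (v : ℝ) (e : Chart n M) {k : ℕ}
    {T T' : Coord n → (Fin (k + 1) → Fin n ⊕ Unit) → ℝ} {O : Set (Coord n)} (hO : IsOpen O)
    (h : ∀ y ∈ O, T y = T' y) {x : Coord n} (hx : x ∈ O) :
    tractorDiv D v e T x = tractorDiv D v e T' x := by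
  ext i
  simp only [tractorDiv, covDeriv, h x hx]
  congr 1
  refine Finset.sum_congr rfl fun a _ => ?_
  rw [pd_congr_of_isOpen hO hx (fun y hy => by rw [h y hy])]

theorem tractorDiv_eq_zero_of_slots (D : TorsionFreeConnection n M) (v : ℝ) (e : Chart n M) {k : ℕ}
    {T : Coord n → (Fin (k + 1) → Fin n ⊕ Unit) → ℝ} (hT : ∀ x, IsSymm (T x)) {x : Coord n} {α : ℕ}
    (h : ∀ β, α ≤ β → β ≤ k → ∀ i : Fin β → Fin n, tractorDiv D v e T x (slotIndex k i) = 0)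
    (I : Fin k → Fin n ⊕ Unit) (hI : α ≤ leftCount I) : tractorDiv D v e T x I = 0 := by
  obtain ⟨β, hβ, i, hi⟩ := exists_slotIndex I
  have h1 : leftCount I = β := by
    rw [← leftCount_slotIndex hβ i, leftCount, hi, leftCount]
  rw [(isSymm_tractorDiv D v e hT x).congr_values hi, h β (h1 ▸ hI) hβ]

/-- The slots of a tractor whose divergence has vanishing slots of valence at least `α`. -/
theorem slot_eq_of_tractorDiv_eq_zero (D : TorsionFreeConnection n M) (v : ℝ) (e : Chart n M)
    {k : ℕ} {V : Coord n → (Fin (k + 1) → Fin n) → ℝ}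
    (hV : ∀ I, ContDiffOn ℝ ∞ (fun y => V y I) e.1.target) {α : ℕ}
    (hc : ∀ δ, α ≤ δ → δ < k + 1 → v + n + (k + 1 : ℕ) + δ ≠ 0)
    {T : Coord n → (Fin (k + 1) → Fin n ⊕ Unit) → ℝ} (hT : ∀ x, IsSymm (T x))
    (htop : ∀ x ∈ e.1.target, ∀ i, T x (slotIndex (k + 1) i) = V x i)
    (h : ∀ β, α ≤ β → β ≤ k → ∀ x ∈ e.1.target, ∀ i : Fin β → Fin n,
      tractorDiv D v e T x (slotIndex k i) = 0)
    {γ : ℕ} (hα : α ≤ γ) (hγ : γ ≤ k + 1) {x : Coord n} (hx : x ∈ e.1.target) (i : Fin γ → Fin n) :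
    T x (slotIndex (k + 1) i) = slotFactor n (k + 1) v γ * tower D v e V γ x i := by
  refine eq_slotFactor_mul_tower D v e hV hc
    (W := fun γ y i => T y (slotIndex (k + 1) i)) (fun x hx => funext (htop x hx))
    (fun β hβ hβk x hx i => ?_) γ hα hγ x hx i
  rw [← h β hβ (by omega) x hx i, tractorDiv_slotIndex D v e hT x (by omega)]
  push_cast
  ring

/-- The tractor whose slots of valence at least `α` are those of the lift of `V`, and whose other
slots are zero. -/
def partialLift (D : TorsionFreeConnection n M) (v : ℝ) (e : Chart n M) {k : ℕ}
    (V : Coord n → (Fin k → Fin n) → ℝ) (α : ℕ) (x : Coord n) : (Fin k → Fin n ⊕ Unit) → ℝ :=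
  ofSlots k fun γ i => if α ≤ γ then slotFactor n k v γ * tower D v e V γ x i else 0

/-! ### Partial lifts and invariance at the excluded weights -/

section PartialLift

variable (D : TorsionFreeConnection n M) (v : ℝ) (e : Chart n M) {k : ℕ}

theorem isSymm_partialLift (V : Coord n → (Fin k → Fin n) → ℝ) (α : ℕ) (x : Coord n) :
    IsSymm (partialLift D v e V α x) :=
  isSymm_ofSlots _ _

theorem partialLift_slotIndex {V : Coord n → (Fin k → Fin n) → ℝ} (hVs : ∀ x, IsSymm (V x))
    (α : ℕ) (x : Coord n) {γ : ℕ} (hγ : γ ≤ k) (i : Fin γ → Fin n) :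
    partialLift D v e V α x (slotIndex k i)
      = if α ≤ γ then slotFactor n k v γ * tower D v e V γ x i else 0 := by
  refine ofSlots_slotIndex hγ ?_ i
  intro I σ
  simp only [isSymm_tower D v e hVs γ x I σ]

theorem contDiffOn_partialLift {V : Coord n → (Fin k → Fin n) → ℝ}
    (hV : ∀ I, ContDiffOn ℝ ∞ (fun y => V y I) e.1.target) (α : ℕ) (I : Fin k → Fin n ⊕ Unit) :
    ContDiffOn ℝ ∞ (fun y => partialLift D v e V α y I) e.1.target := by
  obtain ⟨γ, -, i, h⟩ := exists_ofSlots_eq (n := n) k I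
  simp only [partialLift, h]
  split_ifs
  · exact contDiffOn_const.mul (contDiffOn_tower D v e hV γ i)
  · exact contDiffOn_const

theorem partialLift_top {V : Coord n → (Fin k → Fin n) → ℝ} (hVs : ∀ x, IsSymm (V x))
    {α : ℕ} (hα : α ≤ k) (x : Coord n) (i : Fin k → Fin n) :
    partialLift D v e V α x (slotIndex k i) = V x i := by
  rw [partialLift_slotIndex D v e hVs α x le_rfl, if_pos hα, slotFactor_self, tower_self, one_mul]

variable {V : Coord n → (Fin (k + 1) → Fin n) → ℝ}

/-- Only the slots above `β` are prescribed. When the coefficient `v + n + (k + 1) + β` vanishes,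
the slot `β` of the divergence is therefore a multiple of `tower`, whatever the slot `β` of `T` is.
-/
theorem tractorDiv_slotIndex_of_slots (hV : ∀ I, ContDiffOn ℝ ∞ (fun y => V y I) e.1.target)
    {T : Coord n → (Fin (k + 1) → Fin n ⊕ Unit) → ℝ} (hT : ∀ x, IsSymm (T x)) {β : ℕ} (hβ : β ≤ k)
    (hc : β + 1 < k + 1 → v + n + (k + 1 : ℕ) + (β + 1 : ℕ) ≠ 0)
    (h : ∀ γ, β < γ → γ ≤ k + 1 → ∀ x ∈ e.1.target, ∀ i : Fin γ → Fin n,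
      T x (slotIndex (k + 1) i) = slotFactor n (k + 1) v γ * tower D v e V γ x i)
    {x : Coord n} (hx : x ∈ e.1.target) (i : Fin β → Fin n) :
    tractorDiv D v e T x (slotIndex k i)
      = slotFactor n (k + 1) v (β + 1) * tower D v e V β x i
        + (v + n + (k + 1 : ℕ) + β) * T x (slotIndex (k + 1) i) := by
  rw [tractorDiv_slotIndex D v e hT x hβ,
    ← covDiv_sub_schoutenContract_tower D v e hV (Nat.lt_succ_of_le hβ) hc hx i,
    covDiv_congr D v e e.1.open_target
      (fun y hy => funext (h (β + 1) (by omega) (by omega) y hy)) hx]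
  have h5 : ((k : ℝ) - β) * schoutenContract D e
        (fun y (i' : Fin (β + 2) → Fin n) => T y (slotIndex (k + 1) i')) x i
      = (k - β) * schoutenContract D e
        (fun y I => slotFactor n (k + 1) v (β + 2) * tower D v e V (β + 2) y I) x i := by
    by_cases h6 : β + 2 ≤ k + 1
    · simp only [schoutenContract, h (β + 2) (by omega) h6 x hx]
    · have h7 : (k : ℝ) = β := by
        have : k = β := by omega
        exact_mod_cast this
      rw [h7]; ring
  rw [h5]
  push_cast
  ring

theorem tractorDiv_partialLift (hV : ∀ I, ContDiffOn ℝ ∞ (fun y => V y I) e.1.target)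
    (hVs : ∀ x, IsSymm (V x)) {α : ℕ}
    (hc : ∀ δ, α ≤ δ → δ < k + 1 → v + n + (k + 1 : ℕ) + δ ≠ 0) {β : ℕ} (hα : α ≤ β) (hβ : β ≤ k)
    {x : Coord n} (hx : x ∈ e.1.target) (i : Fin β → Fin n) :
    tractorDiv D v e (partialLift D v e V α) x (slotIndex k i) = 0 := by
  rw [tractorDiv_slotIndex_of_slots D v e hV (isSymm_partialLift D v e V α) hβ
    (fun h => hc _ (by omega) h)
    (fun γ h1 h2 y _ i' => by rw [partialLift_slotIndex D v e hVs α y h2, if_pos (by omega)]) hx,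
    partialLift_slotIndex D v e hVs α x (by omega), if_pos hα,
    slotFactor_succ (Nat.lt_succ_of_le hβ) (hc β hα (by omega))]
  ring

/-- At the excluded weight, `tower` is projectively invariant. -/
theorem tower_projectiveChange (hn : 2 ≤ n) {D D' : TorsionFreeConnection n M} {Υ : OneForm n M}
    (h : IsProjectiveChange D D' Υ) (hV : ∀ I, ContDiffOn ℝ ∞ (fun y => V y I) e.1.target)
    (hVs : ∀ x, IsSymm (V x)) {β : ℕ} (hβ : β ≤ k) (hc0 : v + n + (k + 1 : ℕ) + β = 0)
    (hc : ∀ δ, β + 1 ≤ δ → δ < k + 1 → v + n + (k + 1 : ℕ) + δ ≠ 0)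
    {x : Coord n} (hx : x ∈ e.1.target) (i : Fin β → Fin n) :
    tower D v e V β x i = tower D' v e V β x i := by
  -- The slot `β` cannot be determined, since its coefficient is zero. It is set to zero together
  -- with all lower ones.
  set T := partialLift D v e V (β + 1) with hTdef
  have hTs : ∀ x, IsSymm (T x) := isSymm_partialLift D v e V (β + 1)
  set T' : Coord n → (Fin (k + 1) → Fin n ⊕ Unit) → ℝ :=
    fun y => tensorAct (splittingChange (Υ.comp e y)) (T y) with hT'def
  have hT's : ∀ x, IsSymm (T' x) := fun x => (hTs x).tensorAct _
  have hX : ∀ y ∈ e.1.target, tractorDiv D' v e T' y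
      = tensorAct (splittingChange (Υ.comp e y)) (tractorDiv D v e T y) := fun y hy =>
    funext (tractorDiv_projectiveChange hn h v hy fun I => differentiableAt_of_contDiffOn
      e.1.open_target (contDiffOn_partialLift D v e hV _ I) hy)
  have hX0 : ∀ y ∈ e.1.target, ∀ I, β + 1 ≤ leftCount I → tractorDiv D v e T y I = 0 :=
    fun y hy => tractorDiv_eq_zero_of_slots D v e hTs fun γ h1 h2 i =>
      tractorDiv_partialLift D v e hV hVs hc h1 h2 hy i
  -- The divergence has no slots above `β`, so those of valence at least `β` are the same in both
  -- splittings.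
  have hX1 : ∀ y ∈ e.1.target, ∀ γ, β ≤ γ → γ ≤ k → ∀ i : Fin γ → Fin n,
      tractorDiv D' v e T' y (slotIndex k i) = tractorDiv D v e T y (slotIndex k i) := by
    intro y hy γ h1 h2 i
    rw [hX y hy]
    exact tensorAct_splittingChange_slotIndex _ h2 (fun I hI => hX0 y hy I (by omega)) i
  -- Uniqueness of the slots above `β`, applied in the splitting of `D'`: they are the ones built
  -- from `D'`.
  have hslots : ∀ γ, β < γ → γ ≤ k + 1 → ∀ y ∈ e.1.target, ∀ i : Fin γ → Fin n,
      T' y (slotIndex (k + 1) i) = slotFactor n (k + 1) v γ * tower D' v e V γ y i := by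
    intro γ h1 h2 y hy i
    refine slot_eq_of_tractorDiv_eq_zero D' v e hV hc hT's (fun y hy i => ?_)
      (fun γ h1 h2 y hy i => ?_) h1 h2 hy i
    · rw [hT'def]
      simp only
      rw [tensorAct_splittingChange_slotIndex _ le_rfl
        (fun I hI => absurd (leftCount_le I) (by omega)),
        hTdef, partialLift_top D v e hVs (by omega)]
    · rw [hX1 y hy γ (by omega) h2]
      exact tractorDiv_partialLift D v e hV hVs hc h1 h2 hy i
  have h1 := hX1 x hx β le_rfl hβ i
  rw [tractorDiv_slotIndex_of_slots D' v e hV hT's hβ (fun h => hc _ le_rfl h) hslots hx,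
    tractorDiv_slotIndex_of_slots D v e hV hTs hβ (fun h => hc _ le_rfl h)
      (fun γ h1 h2 y _ i' => by
        rw [hTdef, partialLift_slotIndex D v e hVs _ y h2, if_pos (by omega)]) hx,
    hc0, zero_mul, zero_mul, add_zero, add_zero] at h1
  -- The common factor involves only the coefficients above `β`, which are nonzero.
  exact (mul_left_cancel₀ (slotFactor_ne_zero hc) h1).symm

end PartialLift

end LocalLifts

/-! ## Sections of tractor bundles -/

section Sections

variable {n : ℕ} {M : Type*} [TopologicalSpace M] [ChartedSpace (Coord n) M]
  {p : ProjectiveStructure n M}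

theorem ProjectiveStructure.nonempty_connection (p : ProjectiveStructure n M) :
    Nonempty p.Connection :=
  let ⟨D, hD⟩ := Quotient.exists_rep p
  ⟨⟨D, hD⟩⟩

theorem ProjectiveStructure.exists_isProjectiveChange [IsManifold (𝓡 n) ∞ M]
    (D D' : p.Connection) : ∃ Υ : OneForm n M, IsProjectiveChange D.1 D'.1 Υ :=
  have h : SameGeodesics D.1 D'.1 := Quotient.exact (D.2.trans D'.2.symm)
  h.exists_isProjectiveChange

namespace TractorField

theorem sum_tractorD {k : ℕ} {v : ℝ} [NeZero (k + 1)]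
    (T : TractorField p (k + 1) (v + (k + 1 : ℕ))) (D : p.Connection) (e : Chart n M) (x : Coord n)
    (I : Fin (k + 1) → Fin n ⊕ Unit) :
    ∑ A : Fin n ⊕ Unit, T.tractorD D e x A (Function.update I 0 A)
      = tractorDiv D.1 v e (T.comp D e) x (Fin.tail I) := by
  have h1 : ∀ A, Function.update I 0 A = Matrix.vecCons A (Fin.tail I) := by
    intro A
    conv_lhs => rw [← Fin.cons_self_tail I]
    exact Fin.update_cons_zero _ _ _
  rw [Fintype.sum_sum_type]
  simp only [h1, tractorD, add_sub_cancel_right, Finset.univ_unique, Finset.sum_singleton,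
    tractorDiv]
  push_cast
  rfl

theorem isDFree_iff {k : ℕ} {v : ℝ} [NeZero (k + 1)]
    (T : TractorField p (k + 1) (v + (k + 1 : ℕ))) :
    T.IsDFree ↔ ∀ D e, ∀ x ∈ e.1.target, ∀ I, tractorDiv D.1 v e (T.comp D e) x I = 0 := by
  constructor
  · intro h D e x hx I
    -- The first entry is overwritten by the summation index, so any value serves.
    have h1 := h D e x hx (Matrix.vecCons (Sum.inr ()) I)
    rw [sum_tractorD] at h1
    exact h1
  · intro h D e x hx I
    rw [sum_tractorD]
    exact h D e x hx _

theorem tractorDiv_eq_zero_iff {k : ℕ} {v : ℝ} (T : TractorField p (k + 1) (v + (k + 1 : ℕ)))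
    (hT : T.IsSymmetric) (D : p.Connection) (e : Chart n M) (x : Coord n) :
    (∀ I, tractorDiv D.1 v e (T.comp D e) x I = 0) ↔ ∀ β < k + 1, ∀ i : Fin β → Fin n,
      covDiv D.1 v e (T.slot D e (β + 1)) x i
        + (v + n + (k + 1 : ℕ) + (β + 1) - 1) * T.slot D e β x i
        - ((k + 1 : ℕ) - (β + 1)) * schoutenContract D.1 e (T.slot D e (β + 2)) x i = 0 := by
  have h1 : ∀ β < k + 1, ∀ i : Fin β → Fin n,
      tractorDiv D.1 v e (T.comp D e) x (slotIndex k i)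
        = covDiv D.1 v e (T.slot D e (β + 1)) x i
          + (v + n + (k + 1 : ℕ) + (β + 1) - 1) * T.slot D e β x i
          - ((k + 1 : ℕ) - (β + 1)) * schoutenContract D.1 e (T.slot D e (β + 2)) x i := by
    intro β hβ i
    rw [tractorDiv_slotIndex D.1 v e (hT D e) x (Nat.le_of_lt_succ hβ)]
    have h2 : ∀ γ, T.slot D e γ =
        fun y (i' : Fin γ → Fin n) => T.comp D e y (slotIndex (k + 1) i') :=
      fun _ => rfl
    rw [h2, h2, h2]
    push_cast
    ring
  constructor
  · intro h β hβ i
    rw [← h1 β hβ, h]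
  · intro h I
    exact tractorDiv_eq_zero_of_slots D.1 v e (hT D e) (α := 0)
      (fun β _ hβ i => by rw [h1 β (Nat.lt_succ_of_le hβ), h β (Nat.lt_succ_of_le hβ)]) I
      (Nat.zero_le _)

/-- Weyl's theorem supplies a one-form relating the two splittings, and the divergence transforms
linearly under it. -/
theorem tractorDiv_eq_zero_of_connection [IsManifold (𝓡 n) ∞ M] (hn : 2 ≤ n) {k : ℕ} {v : ℝ}
    (T : TractorField p (k + 1) (v + (k + 1 : ℕ))) (D D' : p.Connection) (e : Chart n M)
    {x : Coord n} (hx : x ∈ e.1.target)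
    (h : ∀ I, tractorDiv D.1 v e (T.comp D e) x I = 0) (I : Fin k → Fin n ⊕ Unit) :
    tractorDiv D'.1 v e (T.comp D' e) x I = 0 := by
  obtain ⟨Υ, hΥ⟩ := ProjectiveStructure.exists_isProjectiveChange D D'
  rw [tractorDiv_congr D'.1 v e e.1.open_target (fun y hy => T.change D D' Υ hΥ e y hy) hx,
    tractorDiv_projectiveChange hn hΥ v hx
      (fun I => differentiableAt_of_contDiffOn e.1.open_target (T.smooth D e I) hx)]
  exact tensorAct_eq_zero _ h I

end TractorField

open Classical in
/-- The lift of a symmetric tensor at a weight which is not excluded. -/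
def lift [IsManifold (𝓡 n) ∞ M] (hn : 2 ≤ n) (p : ProjectiveStructure n M) {k : ℕ} {v : ℝ}
    (hc : ∀ δ < k + 1, v + n + (k + 1 : ℕ) + δ ≠ 0) (V : SymmetricTensorField n M (k + 1) v) :
    TractorField p (k + 1) (v + (k + 1 : ℕ)) where
  comp D e x := if x ∈ e.1.target then partialLift D.1 v e (V.1.comp e) 0 x else 0
  smooth D e I := (contDiffOn_partialLift D.1 v e (V.1.smooth e) 0 I).congr fun x hx => by
    rw [if_pos hx]
  transform D e e' x hx I := by
    rw [if_pos (mem_target_of_mem_overlap hx), if_pos (transition_mem_target hx),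
      add_sub_cancel_right]
    have hsym := (isSymm_partialLift D.1 v e (V.1.comp e) 0 x).tensorAct (tractorJac e e' x)
    refine congrFun (IsSymm.eq_of_slots (isSymm_partialLift D.1 v e' (V.1.comp e') 0 _)
      (T := fun I => |(jac e e' x).det| ^ (v / (n + 1)) * tensorAct (tractorJac e e' x)
        (partialLift D.1 v e (V.1.comp e) 0 x) I)
      (fun J σ => congrArg (_ * ·) (hsym J σ)) fun γ hγ i => ?_) I
    rw [tractorJac, tensorAct_fromBlocks_slotIndex _ hγ,
      partialLift_slotIndex D.1 v e' (V.2 e') 0 _ hγ, if_pos (Nat.zero_le _),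
      tower_chart D.1 v (V.1.smooth e) (V.1.smooth e')
        (fun y hy J => V.1.transform e e' y hy J) γ x hx i, densityFactor]
    simp only [partialLift_slotIndex D.1 v e (V.2 e) 0 x hγ, if_pos (Nat.zero_le _),
      tensorAct_const_mul]
    ring
  change D D' Υ h e x hx := by
    rw [if_pos hx, if_pos hx]
    have hs : ∀ D : p.Connection, ∀ y, IsSymm (partialLift D.1 v e (V.1.comp e) 0 y) := fun D y =>
      isSymm_partialLift D.1 v e (V.1.comp e) 0 y
    have hs' := fun y => (hs D y).tensorAct (splittingChange (Υ.comp e y))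
    refine (hs D' x).eq_of_slots (hs' x) fun γ hγ i => ?_
    rw [partialLift_slotIndex D'.1 v e (V.2 e) 0 x hγ, if_pos (Nat.zero_le _)]
    -- The lift built with `D`, transformed to the splitting of `D'`, has the same top slot and zero
    -- divergence. Uniqueness identifies it with the lift built with `D'`.
    refine (slot_eq_of_tractorDiv_eq_zero D'.1 v e (V.1.smooth e) (α := 0)
      (fun δ _ hδ => hc δ hδ) hs' (fun y hy i => ?_) (fun β h1 h2 y hy i => ?_)
      (Nat.zero_le γ) hγ hx i).symm
    · rw [tensorAct_splittingChange_slotIndex _ le_rfl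
        (fun I hI => absurd (leftCount_le I) (by omega)),
        partialLift_top D.1 v e (V.2 e) (Nat.zero_le _)]
    · rw [tractorDiv_projectiveChange hn h v hy fun I => differentiableAt_of_contDiffOn
        e.1.open_target (contDiffOn_partialLift D.1 v e (V.1.smooth e) 0 I) hy]
      refine tensorAct_eq_zero _ (fun I => ?_) _
      exact tractorDiv_eq_zero_of_slots D.1 v e (hs D) (fun β _ h2 i =>
        tractorDiv_partialLift D.1 v e (V.1.smooth e) (V.2 e) (fun δ _ hδ => hc δ hδ)
          (Nat.zero_le β) h2 hy i) I (Nat.zero_le _)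
  zero_off D e x hx := if_neg hx

theorem existsUnique_lift [IsManifold (𝓡 n) ∞ M] (hn : 2 ≤ n) (p : ProjectiveStructure n M) {k : ℕ}
    [NeZero (k + 1)] {v : ℝ} (hc : ∀ δ < k + 1, v + n + (k + 1 : ℕ) + δ ≠ 0)
    (V : SymmetricTensorField n M (k + 1) v) :
    ∃! T : TractorField p (k + 1) (v + (k + 1 : ℕ)), T.IsSymmetric ∧ T.IsLiftOf V ∧ T.IsDFree := by
  have htop : ∀ i : Fin (k + 1) → Fin n, (fun j => Sum.inl (i j)) = slotIndex (k + 1) i := by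
    intro i
    funext j
    rw [slotIndex, dif_pos j.2]
  refine ⟨lift hn p hc V, ⟨fun D e x I σ => ?_, fun D e x i => ?_, ?_⟩, fun T hT => ?_⟩
  · by_cases hx : x ∈ e.1.target
    · simp only [lift, if_pos hx]
      exact isSymm_partialLift D.1 v e (V.1.comp e) 0 x I σ
    · simp only [lift, if_neg hx]
      rfl
  · by_cases hx : x ∈ e.1.target
    · simp only [lift, if_pos hx]
      rw [htop, partialLift_top D.1 v e (V.2 e) (Nat.zero_le _)]
    · simp only [lift, if_neg hx]
      rw [V.1.zero_off e x hx]
      rfl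
  · rw [TractorField.isDFree_iff]
    intro D e x hx I
    rw [tractorDiv_congr D.1 v e (T' := partialLift D.1 v e (V.1.comp e) 0) e.1.open_target
      (fun y hy => by simp only [lift, if_pos hy]) hx]
    exact tractorDiv_eq_zero_of_slots D.1 v e (isSymm_partialLift D.1 v e _ 0) (fun β _ h2 i =>
        tractorDiv_partialLift D.1 v e (V.1.smooth e) (V.2 e) (fun δ _ hδ => hc δ hδ)
          (Nat.zero_le β) h2 hx i) I (Nat.zero_le _)
  · obtain ⟨h1, h2, h3⟩ := hT
    rw [TractorField.isDFree_iff] at h3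
    have h4 : T.comp = (lift hn p hc V).comp := by
      funext D e x
      by_cases hx : x ∈ e.1.target
      · simp only [lift, if_pos hx]
        refine IsSymm.eq_of_slots (h1 D e x) (isSymm_partialLift D.1 v e _ 0 x) fun γ hγ i => ?_
        rw [partialLift_slotIndex D.1 v e (V.2 e) 0 x hγ, if_pos (Nat.zero_le _)]
        exact slot_eq_of_tractorDiv_eq_zero D.1 v e (V.1.smooth e) (α := 0)
          (fun δ _ hδ => hc δ hδ) (h1 D e) (fun y hy i => by rw [← htop, h2 D e y i])
          (fun β _ _ y hy i => h3 D e y hy _) (Nat.zero_le γ) hγ hx i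
      · rw [T.zero_off D e x hx, (lift hn p hc V).zero_off D e x hx]
    -- The remaining fields are proofs, so equality of the components suffices.
    cases T
    cases hL : lift hn p hc V
    rw [hL] at h4
    simp only at h4
    subst h4
    rfl

open Classical in
/-- The symmetric tensor given by `tower` in the splitting of a connection. -/
def towerField [IsManifold (𝓡 n) ∞ M] (D : TorsionFreeConnection n M) {k : ℕ} {v : ℝ}
    (V : SymmetricTensorField n M k v) (β : ℕ) : SymmetricTensorField n M β v :=
  ⟨{ comp := fun e x => if x ∈ e.1.target then tower D v e (V.1.comp e) β x else 0
     smooth := fun e i => (contDiffOn_tower D v e (V.1.smooth e) β i).congr fun x hx => by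
       rw [if_pos hx]
     transform := fun e e' x hx i => by
       rw [if_pos (mem_target_of_mem_overlap hx), if_pos (transition_mem_target hx)]
       exact tower_chart D v (V.1.smooth e) (V.1.smooth e')
         (fun y hy J => V.1.transform e e' y hy J) β x hx i
     zero_off := fun e x hx => if_neg hx },
    fun e x i σ => by
      by_cases hx : x ∈ e.1.target
      · simp only [if_pos hx]
        exact isSymm_tower D v e (V.2 e) β x i σ
      · simp only [if_neg hx]
        rfl⟩

end Sections

end ProjectiveTractor

end

/-! ### Assembly of the three statements -/

theorem mainTheorem12 (n : ℕ) (hn : 2 ≤ n) :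
    -- existence and uniqueness of the lift for non-excluded weights
    (∀ (M : Type*) [TopologicalSpace M] [ChartedSpace (Coord n) M] [IsManifold (𝓡 n) ∞ M]
      (p : ProjectiveStructure n M) (k : ℕ) [NeZero k] (v : ℝ),
      (∀ α ∈ Finset.Icc 1 k, v ≠ -((n : ℝ) + k + α - 1)) →
      ∀ V : SymmetricTensorField n M k v,
        ∃! T : TractorField p k (v + k), T.IsSymmetric ∧ T.IsLiftOf V ∧ T.IsDFree) ∧
    -- the equation `D_A V^{A I₂ … I_k} = 0` as a triangular system, in any connection of the class
    (∀ (M : Type*) [TopologicalSpace M] [ChartedSpace (Coord n) M] [IsManifold (𝓡 n) ∞ M]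
      (p : ProjectiveStructure n M) (k : ℕ) [NeZero k] (v : ℝ)
      (T : TractorField p k (v + k)), T.IsSymmetric → ∀ D : p.Connection,
        (T.IsDFree ↔
          ∀ e, ∀ x ∈ e.1.target, ∀ β < k, ∀ i : Fin β → Fin n,
            covDiv D.1 v e (T.slot D e (β + 1)) x i
              + (v + n + k + (β + 1) - 1) * T.slot D e β x i
              - (k - (β + 1)) * schoutenContract D.1 e (T.slot D e (β + 2)) x i = 0)) ∧
    -- the excluded weights `v = -(n + k + α - 1)`, with `α = β + 1` and `k = β + m`
    (∀ β m : ℕ, 1 ≤ m → ∀ v : ℝ, v = -((n : ℝ) + (β + m) + (β + 1) - 1) →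
      ∃ c : DiffWord (β + m) β →₀ ℝ, (∀ w ∈ c.support, 1 ≤ w.curvatureDegree) ∧
        ∀ (M : Type*) [TopologicalSpace M] [ChartedSpace (Coord n) M] [IsManifold (𝓡 n) ∞ M]
          (p : ProjectiveStructure n M),
          ∃ L : SymmetricTensorField n M (β + m) v → SymmetricTensorField n M β v,
            ∀ (V : SymmetricTensorField n M (β + m) v) (D : p.Connection) (e : Chart n M),
              ∀ x ∈ e.1.target, ∀ i : Fin β → Fin n,
                (L V).1.comp e x i =
                  iterDiv D.1 v e m (V.1.comp e) x i
                    + c.sum fun w r => r * w.eval D.1 v e (V.1.comp e) x i) := by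
  refine ⟨fun M _ _ _ p k _ v hv V => ?_, fun M _ _ _ p k _ v T hT D => ?_,
    fun β m hm v hv => ?_⟩
  · obtain ⟨k, rfl⟩ : ∃ k', k = k' + 1 := Nat.exists_eq_succ_of_ne_zero (NeZero.ne k)
    refine existsUnique_lift hn p (fun δ hδ h0 => ?_) V
    refine hv (δ + 1) (Finset.mem_Icc.2 ⟨by omega, by omega⟩) ?_
    push_cast at h0 ⊢
    linarith
  · obtain ⟨k, rfl⟩ : ∃ k', k = k' + 1 := Nat.exists_eq_succ_of_ne_zero (NeZero.ne k)
    rw [TractorField.isDFree_iff]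
    constructor
    · intro h e x hx
      exact (T.tractorDiv_eq_zero_iff hT D e x).1 (h D e x hx)
    · intro h D' e x hx
      exact T.tractorDiv_eq_zero_of_connection hn D D' e hx
        ((T.tractorDiv_eq_zero_iff hT D e x).2 (h e x hx))
  · obtain ⟨c, hc, H⟩ := DiffWord.exists_tower_eq n (β + m) v β (by omega)
    refine ⟨c, hc, fun M _ _ _ p => ?_⟩
    -- The operator is defined with one connection of the class, and invariance gives the formula
    -- for every other one.
    obtain ⟨D₀⟩ := p.nonempty_connection
    refine ⟨fun V => towerField D₀.1 V β, fun V D e x hx i => ?_⟩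
    obtain ⟨Υ, hΥ⟩ := ProjectiveStructure.exists_isProjectiveChange D₀ D
    have h1 : (towerField D₀.1 V β).1.comp e x i = tower D₀.1 v e (V.1.comp e) β x i := by
      simp only [towerField, if_pos hx]
    have h2 : tower D₀.1 v e (V.1.comp e) β x i = tower D.1 v e (V.1.comp e) β x i := by
      -- Since `m ≥ 1`, the valence is a successor, the form used for divergences. It is generalized
      -- so that it can be substituted in the type of `V`.
      obtain ⟨k, hk⟩ : ∃ k, β + m = k + 1 := ⟨β + m - 1, by omega⟩
      have hkr : (β : ℝ) + m = k + 1 := by exact_mod_cast hk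
      have hβ : β ≤ k := by omega
      rw [hkr] at hv
      clear H hc c h1
      generalize β + m = K at V hk
      subst hk
      refine tower_projectiveChange v e hn hΥ (V.1.smooth e) (V.2 e) hβ ?_
        (fun δ hδ _ => ?_) hx i
      · rw [hv]
        push_cast
        ring
      -- At this weight the coefficient of valence `δ` is `δ - β`, which is positive above `β`.
      · have h3 : (β : ℝ) + 1 ≤ δ := by exact_mod_cast hδ
        rw [hv]
        push_cast
        intro h4
        linarith
    rw [h1, h2, H M D.1 e (V.1.comp e) (V.1.smooth e) x hx i,
      Finsupp.sum_add_index' (by simp) (by intros; ring), Finsupp.sum_single_index (by simp),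
      one_mul, DiffWord.eval_divWord]
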